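/- Let $k\ge 1$ and let $\Lambda$ be a finite, strongly connected $k$-graph: a countable small category with a degree functor $d:\Lambda\to\mathbb N^k$ having the unique factorization property, such that $\Lambda^n=d^{-1}(n)$ is finite for every $n\in\mathbb N^k$ and such that for all vertices $v,w$ there is a morphism with range $v$ and source $w$. For $1\le i\le k$ let $A_i(v,w)$ be the number of morphisms of degree $e_i$ with range $v$ and source $w$, let $\rho_i$ be the spectral radius of the matrix $A_i$, and let $x^\Lambda\in(0,\infty)^{\Lambda^0}$ be the Perron–Frobenius eigenvector of $\Lambda$, i.e. the unique positive vector with $\sum_v x^\Lambda_v=1$ and $A_ix^\Lambda=\rho_ix^\Lambda$ for all $i$. Let $\mathcal B_\Lambda$ be the stationary $k$-Bratteli diagram of $A_1,\dots,A_k$: each vertex set $\mathcal V_n$ ($n\ge 0$) is a copy of $\Lambda^0$, and for $n\ge 1$ with $n\equiv i \pmod k$, $1\le i\le k$, there are $A_i(p,q)$ edges with range $p\in\mathcal V_{n-1}$ and source $q\in\mathcal V_n$. Let $X_{\mathcal B_\Lambda}$ be its space of infinite paths starting at level $0$, $F\mathcal B_\Lambda$ the set of its finite paths with range in $\mathcal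 V_0$ (vertices of $\mathcal V_0$ being the paths of length $0$), and $[\lambda]\subseteq X_{\mathcal B_\Lambda}$ the cylinder set of $\lambda\in F\mathcal B_\Lambda$; $X_{\mathcal B_\Lambda}$ carries the topology generated by the cylinder sets. Fix $\delta\in(0,1)$, and for $\eta\in F\mathcal B_\Lambda$ of length $qk+t$, $0\le t<k$, with source $s(\eta)$, put $$w_\delta(\eta)=\left(\rho_1^{q+1}\cdots\rho_t^{q+1}\rho_{t+1}^{q}\cdots\rho_k^{q}\right)^{-1/\delta}x^\Lambda_{s(\eta)} .$$ Define $d_\delta(x,x)=0$ and, for distinct $x,y\in X_{\mathcal B_\Lambda}$, $d_\delta(x,y)=1$ if $x,y$ have different ranges and $d_\delta(x,y)=w_\delta(x\wedge y)$ otherwise, where $x\wedge y$ is the longest common initial path of $x$ and $y$. Assume that $w_\delta(\lambda)=\operatorname{diam}[\lambda]:=\sup\{d_\delta(x,y):x,y\in[\lambda]\}$ for all $\lambda\in F\mathcal B_\Lambda$. A choice function is a map $\tau=(\tau_+,\tau_-):F\mathcal B_\Lambda\to X_{\mathcal B_\Lambda}\times X_{\mathcal B_\Lambda}$ with $\tau_\pm(\gamma)\in[\gamma]$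 and $d_\delta(\tau_+(\gamma),\tau_-(\gamma))=\operatorname{diam}[\gamma]$ for all $\gamma$. On $\ell^2(F\mathcal B_\Lambda,\mathbb C^2)$ let $$\pi_\tau(f)=\bigoplus_{\gamma\in F\mathcal B_\Lambda}\begin{pmatrix} f(\tau_+(\gamma))&0\\0&f(\tau_-(\gamma))\end{pmatrix},\qquad D=\bigoplus_{\gamma\in F\mathcal B_\Lambda}\frac1{\operatorname{diam}[\gamma]}\begin{pmatrix}0&1\\1&0\end{pmatrix}.$$ Then for every choice function $\tau$ and every $\lambda\in F\mathcal B_\Lambda$ the limit $$\mu_\delta([\lambda])=\lim_{s\searrow1}(s-1)\operatorname{Tr}\left(\left(\pi_\tau(\chi_{[\lambda]})|D|^{-\delta}\right)^s\right)$$ exists and is finite, it does not depend on $\tau$, and the assignment $[\lambda]\mapsto\mu_\delta([\lambda])$, $\lambda\in F\mathcal B_\Lambda$, extends uniquely to a finite Borel measure on $X_{\mathcal B_\Lambda}$. In particular this measure is independent of the choice function $\tau$. -/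

import Mathlib

open CategoryTheory Filter Topology MeasureTheory
open scoped ENNReal InnerProductSpace ComplexOrder

universe u v

noncomputable section

/-! ## Bratteli diagrams, path spaces and ultrametrics -/

/-- A Bratteli diagram. `E n` is the finite set of edges whose source is in `V (n + 1)` and whose
range is in `V n` (so the edge set usually called `𝓔ₙ₊₁`). -/
structure BratteliDiagram where
  V : ℕ → Type u
  E : ℕ → Type u
  finite_V : ∀ n, Finite (V n)
  finite_E : ∀ n, Finite (E n)
  r : ∀ {n}, E n → V n
  s : ∀ {n}, E n → V (n + 1)

namespace BratteliDiagram

variable (B : BratteliDiagram.{u})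

/-- The infinite path space `X_B`. -/
def InfPath : Type u :=
  {x : ∀ n, B.E n // ∀ n, B.s (x n) = B.r (x (n + 1))}

/-- Finite paths of length `n` with range in `V 0`. A path of length `0` is a vertex of `V 0`;
a path of positive length is its sequence of edges (the field `root` is then determined). -/
structure FinPath (n : ℕ) where
  /-- the range of the path -/
  root : B.V 0
  edge : ∀ i : Fin n, B.E i
  root_eq : ∀ h : 0 < n, B.r (edge ⟨0, h⟩) = root
  compat : ∀ (i : ℕ) (h : i + 1 < n),
    B.s (edge ⟨i, Nat.lt_of_succ_lt h⟩) = B.r (edge ⟨i + 1, h⟩)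

/-- `FB`: all finite paths with range in `V 0`; the first component is the length. -/
abbrev Paths : Type u := Σ n, B.FinPath n

variable {B}

/-- The source of a finite path. -/
def FinPath.source : {n : ℕ} → B.FinPath n → B.V n
  | 0, p => p.root
  | n + 1, p => B.s (p.edge (Fin.last n))

/-- The range of an infinite path. -/
def InfPath.range (x : B.InfPath) : B.V 0 := B.r (x.1 0)

/-- The sub-path consisting of the first `n` edges of an infinite path. -/
def InfPath.take (x : B.InfPath) (n : ℕ) : B.FinPath n where
  root := x.range
  edge := fun i => x.1 i
  root_eq := fun _ => rfl
  compat := fun i _ => x.2 i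

/-- The cylinder set `[η]`: infinite paths that have `η` as a sub-path. For a vertex `v` of
`V 0` this is the set of infinite paths with range `v`. -/
def cylinder (η : B.Paths) : Set B.InfPath := {x | x.take η.1 = η.2}

/-- The topology generated by the cylinder sets. -/
instance : TopologicalSpace B.InfPath :=
  TopologicalSpace.generateFrom (Set.range (cylinder (B := B)))

instance : MeasurableSpace B.InfPath := borel _

instance : BorelSpace B.InfPath := ⟨rfl⟩

theorem isClopen_cylinder (η : B.Paths) : IsClopen (cylinder η) := by
  have ho : ∀ ξ : B.Paths, IsOpen (cylinder ξ) := fun ξ =>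
    TopologicalSpace.isOpen_generateFrom_of_mem ⟨ξ, rfl⟩
  refine ⟨⟨?_⟩, ho η⟩
  have h : (cylinder η)ᶜ = ⋃ ξ : {ξ : B.FinPath η.1 // ξ ≠ η.2}, cylinder ⟨η.1, ξ.1⟩ := by
    ext x
    simp only [cylinder, Set.mem_compl_iff, Set.mem_iUnion, Set.mem_ofPred_eq]
    exact ⟨fun hx => ⟨⟨_, hx⟩, rfl⟩, fun ⟨ξ, hξ⟩ hx => ξ.2 (hξ.symm.trans hx)⟩
  rw [h]
  exact isOpen_iUnion fun ξ => ho _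

/-- The characteristic function `χ_[η]` as a (bounded, continuous) function on `X_B`. -/
def cylinderChar (η : B.Paths) : BoundedContinuousFunction B.InfPath ℂ :=
  BoundedContinuousFunction.ofNormedAddCommGroup ((cylinder η).indicator fun _ => (1 : ℂ))
    (continuous_indicator (by simp [(isClopen_cylinder η).frontier_eq])
      continuous_const.continuousOn) 1 fun x => by
      by_cases hx : x ∈ cylinder η <;> simp [hx]

/-- The length of `x ∧ y`, the longest common sub-path of two distinct infinite paths with the
same range: the first position at which the two edge sequences differ. -/
def meetLength (x y : B.InfPath) : ℕ := sInf {n | x.1 n ≠ y.1 n}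

open Classical in
/-- The function `d_w` on `X_B` attached to a function `w` on finite paths. -/
def dist (w : B.Paths → ℝ) (x y : B.InfPath) : ℝ :=
  if x = y then 0
  else if x.range = y.range then w ⟨meetLength x y, x.take (meetLength x y)⟩
  else 1

/-- The diameter of the cylinder set `[η]` with respect to `d_w`. -/
def diam (w : B.Paths → ℝ) (η : B.Paths) : ℝ :=
  sSup {t | ∃ x ∈ cylinder η, ∃ y ∈ cylinder η, t = dist w x y}

/-- Choice functions `τ = (τ₊, τ₋)` for `(X_B, d_w)`. -/
structure ChoiceFunction (w : B.Paths → ℝ) where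
  plus : B.Paths → B.InfPath
  minus : B.Paths → B.InfPath
  plus_mem : ∀ γ, plus γ ∈ cylinder γ
  minus_mem : ∀ γ, minus γ ∈ cylinder γ
  dist_eq : ∀ γ, dist w (plus γ) (minus γ) = diam w γ

end BratteliDiagram

/-! ## Operators on `ℓ²(ι, ℂ²)` and more general Hilbert spaces -/

/-- The Hilbert space `ℓ²(ι, ℂ²)`. -/
abbrev L2C2 (ι : Type u) : Type u := lp (fun _ : ι => EuclideanSpace ℂ (Fin 2)) 2

/-- The orthogonal direct sum of `2 × 2` matrices as a possibly unbounded operator on `ℓ²(ι, ℂ²)`,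
on its maximal domain. -/
def blockDiag {ι : Type u} (a : ι → Matrix (Fin 2) (Fin 2) ℂ) : L2C2 ι →ₗ.[ℂ] L2C2 ι where
  domain :=
    { carrier := {ψ | Memℓp (fun γ => Matrix.toEuclideanCLM (𝕜 := ℂ) (a γ) (ψ γ)) 2}
      zero_mem' := by
        have h : Memℓp (0 : ι → EuclideanSpace ℂ (Fin 2)) 2 := zero_memℓp
        refine cast (congrArg (fun f => Memℓp f 2) ?_) h
        funext γ
        simp
      add_mem' := by
        intro ψ φ hψ hφ
        refine cast (congrArg (fun f => Memℓp f 2) ?_) (Memℓp.add hψ hφ)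
        funext γ
        simp
      smul_mem' := by
        intro c ψ hψ
        refine cast (congrArg (fun f => Memℓp f 2) ?_) (Memℓp.const_smul hψ c)
        funext γ
        simp }
  toFun :=
    { toFun := fun ψ => ⟨fun γ => Matrix.toEuclideanCLM (𝕜 := ℂ) (a γ) (ψ.1 γ), ψ.2⟩
      map_add' := by
        intro ψ φ
        ext1
        funext γ
        exact map_add _ _ _
      map_smul' := by
        intro c ψ
        ext1
        funext γ
        exact map_smul (Matrix.toEuclideanCLM (𝕜 := ℂ) (a γ)) c (ψ.1 γ) }

/-- The orthonormal basis `δ_γ ⊗ e_i` of `ℓ²(ι, ℂ²)`. -/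
def stdBasis (ι : Type u) : HilbertBasis (ι × Fin 2) ℂ (L2C2 ι) := by
  classical
  exact HilbertBasis.mkOfOrthogonalEqBot
    (v := fun p : ι × Fin 2 => lp.single 2 p.1 (EuclideanSpace.single p.2 (1 : ℂ)))
    (by
      rw [orthonormal_iff_ite]
      rintro ⟨γ, i⟩ ⟨γ', i'⟩
      rw [lp.inner_single_left, lp.single_apply]
      by_cases h : γ = γ'
      · subst h
        simp [EuclideanSpace.inner_single_left]
      · simp [h])
    (by
      rw [Submodule.eq_bot_iff]
      intro ψ hψ
      rw [Submodule.mem_orthogonal] at hψ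
      ext1
      funext γ
      ext i
      have := hψ _ (Submodule.subset_span ⟨(γ, i), rfl⟩)
      rw [lp.inner_single_left, EuclideanSpace.inner_single_left] at this
      simpa using this)

theorem stdBasis_apply {ι : Type u} [DecidableEq ι] (p : ι × Fin 2) :
    stdBasis ι p = lp.single 2 p.1 (EuclideanSpace.single p.2 (1 : ℂ)) := by
  rw [stdBasis, HilbertBasis.coe_mkOfOrthogonalEqBot]
  congr 1
  exact Subsingleton.elim _ _

section Hilbert

variable {H : Type u} [NormedAddCommGroup H] [InnerProductSpace ℂ H] [CompleteSpace H]

open Classical in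
/-- The bounded inverse of a possibly unbounded operator `D`: the unique bounded operator `R` with
range in the domain of `D`, `D R = 1` and `R D = 1` on the domain of `D` (and `0` if there is
none). -/
def boundedInverse (D : H →ₗ.[ℂ] H) : H →L[ℂ] H :=
  if h : ∃ R : H →L[ℂ] H, (∀ ψ, ∃ hψ : R ψ ∈ D.domain, D ⟨R ψ, hψ⟩ = ψ) ∧
      ∀ φ : D.domain, R (D φ) = φ
  then h.choose else 0

/-- `|D|^{-t}` for an invertible self-adjoint operator `D` and `t > 0`. Here `|D|⁻¹ = |D⁻¹|`, and
the absolute value and the power are those of the continuous functional calculus. -/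
def absNegPow (D : H →ₗ.[ℂ] H) (t : ℝ) : H →L[ℂ] H := CFC.abs (boundedInverse D) ^ t

/-- The trace, with values in `[0, ∞]`, of a positive operator `T`, computed in a given
orthonormal basis (on which it does not depend). -/
def posTrace {κ : Type*} (b : HilbertBasis κ ℂ H) (T : H →L[ℂ] H) : ℝ≥0∞ :=
  ∑' j, ENNReal.ofReal (⟪b j, T (b j)⟫_ℂ).re

/-- `lim_{s ↘ 1} (s - 1) Tr (T ^ s) = t`, the limit being taken in `[0, ∞]`, and `T ^ s` being
given by the continuous functional calculus of the positive operator `T`. -/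
def HasResidueTrace {κ : Type*} (b : HilbertBasis κ ℂ H) (T : H →L[ℂ] H) (t : ℝ≥0∞) : Prop :=
  Tendsto (fun s : ℝ => ENNReal.ofReal (s - 1) * posTrace b (T ^ s)) (𝓝[>] 1) (𝓝 t)

end Hilbert

/-! ## The Pearson--Bellissard representation and Dirac operator -/

namespace BratteliDiagram

variable {B : BratteliDiagram.{u}}

/-- The Dirac operator `D = ⨁_γ (1 / diam [γ]) (0 1; 1 0)` on `ℓ²(FB, ℂ²)`. -/
def dirac (w : B.Paths → ℝ) : L2C2 B.Paths →ₗ.[ℂ] L2C2 B.Paths :=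
  blockDiag fun γ => ((1 / diam w γ : ℝ) : ℂ) • !![0, 1; 1, 0]

theorem norm_rep_le {w : B.Paths → ℝ} (τ : ChoiceFunction w)
    (f : BoundedContinuousFunction B.InfPath ℂ) (γ : B.Paths) :
    ‖Matrix.toEuclideanCLM (𝕜 := ℂ) !![f (τ.plus γ), 0; 0, f (τ.minus γ)]‖ ≤ ‖f‖ := by
  refine ContinuousLinearMap.opNorm_le_bound _ (norm_nonneg f) fun ψ => ?_
  refine abs_le_of_sq_le_sq' ?_ (by positivity) |>.2
  have h0 := f.norm_coe_le_norm (τ.plus γ)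
  have h1 := f.norm_coe_le_norm (τ.minus γ)
  rw [mul_pow, EuclideanSpace.norm_sq_eq, EuclideanSpace.norm_sq_eq]
  simp only [Fin.sum_univ_two, Matrix.ofLp_toEuclideanCLM, Matrix.mulVec, dotProduct,
    Matrix.of_apply, Matrix.cons_val', Matrix.cons_val_zero, Matrix.cons_val_one,
    Matrix.cons_val_fin_one, zero_mul, add_zero, zero_add, norm_mul, mul_pow, mul_add]
  gcongr

/-- The representation `π_τ(f) = ⨁_γ diag (f (τ₊ γ), f (τ₋ γ))` on `ℓ²(FB, ℂ²)`. -/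
def rep {w : B.Paths → ℝ} (τ : ChoiceFunction w) (f : BoundedContinuousFunction B.InfPath ℂ) :
    L2C2 B.Paths →L[ℂ] L2C2 B.Paths :=
  lp.mapCLM 2 (fun γ => Matrix.toEuclideanCLM (𝕜 := ℂ) !![f (τ.plus γ), 0; 0, f (τ.minus γ)])
    (norm_nonneg f) (norm_rep_le τ f)

/-- `lim_{s ↘ 1} (s - 1) Tr ((π_τ(χ_[η]) |D|^{-δ}) ^ s) = t`. -/
def HasDixmierValue {w : B.Paths → ℝ} (τ : ChoiceFunction w) (δ : ℝ) (η : B.Paths)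
    (t : ℝ≥0∞) : Prop :=
  HasResidueTrace (stdBasis B.Paths) (rep τ (cylinderChar η) * absNegPow (dirac w) δ) t

end BratteliDiagram

/-- The stationary `k`-Bratteli diagram of `A 0, …, A (k-1)`: every `V n` is a copy of `ι`, and
there are `A (n mod k) p q` edges with range `p` in `V n` and source `q` in `V (n + 1)`. -/
def stationaryBratteli {k : ℕ} [NeZero k] {ι : Type u} [Finite ι]
    (A : Fin k → Matrix ι ι ℕ) : BratteliDiagram.{u} where
  V _ := ι
  E n := Σ p : ι, Σ q : ι, Fin (A (Fin.ofNat k n) p q)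
  finite_V _ := inferInstance
  finite_E n := by
    have h : ∀ p : ι, Finite (Σ q : ι, Fin (A (Fin.ofNat k n) p q)) := fun p => inferInstance
    exact inferInstanceAs (Finite (Σ p : ι, Σ q : ι, Fin (A (Fin.ofNat k n) p q)))
  r e := e.1
  s e := e.2.1

/-! ## Higher-rank graphs -/

/-- The structure of a `k`-graph on a countable small category. A morphism `λ` with source `v` and
range `w` is an arrow `v ⟶ w`, so that the product `μν` is `ν ≫ μ`. -/
structure HigherRankGraph (k : ℕ) (V : Type u) [Category.{v} V] where
  countable_obj : Countable V
  countable_hom : ∀ x y : V, Countable (x ⟶ y)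
  deg : ∀ {x y : V}, (x ⟶ y) → (Fin k → ℕ)
  deg_id : ∀ x : V, deg (𝟙 x) = 0
  deg_comp : ∀ {x y z : V} (g : x ⟶ y) (f : y ⟶ z), deg (g ≫ f) = deg f + deg g
  factorization : ∀ {x z : V} (f : x ⟶ z) (m n : Fin k → ℕ), deg f = m + n →
    ∃! p : Σ y : V, (x ⟶ y) × (y ⟶ z),
      deg p.2.2 = m ∧ deg p.2.1 = n ∧ p.2.1 ≫ p.2.2 = f

namespace HigherRankGraph

variable {k : ℕ} {V : Type u} [Category.{v} V] (Λ : HigherRankGraph k V)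

/-- `Λ` is finite: each `Λⁿ` is a finite set. -/
def IsFinite : Prop :=
  ∀ n : Fin k → ℕ, Finite {f : Σ x : V, Σ y : V, (x ⟶ y) // Λ.deg f.2.2 = n}

/-- `Λ` is strongly connected: for all vertices `v`, `w` there is a morphism with range `v` and
source `w`. -/
def StronglyConnected (_ : HigherRankGraph k V) : Prop := ∀ v w : V, Nonempty (w ⟶ v)

/-- The `i`-th adjacency matrix: `A i v w` is the number of morphisms of degree `e_i` with range
`v` and source `w`. -/
def adj (i : Fin k) : Matrix V V ℕ :=
  Matrix.of fun v w => Nat.card {f : w ⟶ v // Λ.deg f = Pi.single i 1}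

variable [Fintype V] [DecidableEq V]

/-- The spectral radius `ρ_i` of the `i`-th adjacency matrix. -/
def rho (i : Fin k) : ℝ :=
  (spectralRadius ℂ ((Λ.adj i).map (Nat.cast : ℕ → ℂ))).toReal

/-- The conditions that characterise the Perron--Frobenius eigenvector. -/
def IsPerronFrobenius (x : V → ℝ) : Prop :=
  (∀ v, 0 < x v) ∧ ∑ v, x v = 1 ∧
    ∀ i, ((Λ.adj i).map (Nat.cast : ℕ → ℝ)).mulVec x = Λ.rho i • x

open Classical in
/-- The Perron--Frobenius eigenvector `x^Λ` (it exists and is unique if `Λ` is finite, strongly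
connected and non-empty; the value `0` is used if there is none). -/
def perron : V → ℝ := if h : ∃ x, Λ.IsPerronFrobenius x then h.choose else 0

variable [NeZero k]

/-- The stationary `k`-Bratteli diagram `B_Λ`. -/
def bratteli : BratteliDiagram.{u} := stationaryBratteli Λ.adj

/-- The weight `w_δ` on `FB_Λ`: for a path `η` of length `n = q k + t` with `0 ≤ t < k`, it is
`(ρ₁^{q+1} ⋯ ρ_t^{q+1} ρ_{t+1}^q ⋯ ρ_k^q)^{-1/δ} x^Λ_{s(η)}`. -/
def weight (δ : ℝ) (η : Λ.bratteli.Paths) : ℝ :=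
  (∏ i : Fin k, Λ.rho i ^ (if (i : ℕ) < η.1 % k then η.1 / k + 1 else η.1 / k)) ^ (-1 / δ)
    * Λ.perron (show V from η.2.source)

end HigherRankGraph

end

noncomputable section

/-! In the basis `δ_γ ⊗ e_i` both `π_τ(χ_[η])` and `|D|^{-δ}` are diagonal, so the trace at `s` is
the sum over `γ` of `(χ(τ₊ γ) + χ(τ₋ γ)) diam[γ]^{δs}` (`hasDixmierValue_iff`). Let `η` have length
`m`. The cylinder of a path `γ` of length at least `m` lies inside `[η]` or misses it, so `τ` enters
only through the finitely many shorter paths, and their share is killed by the factor `s - 1`.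

The longer paths are counted by products of adjacency matrices, which are periodic in the level with
period `k`. Writing the number of added edges as `qk + t` yields series `∑ r^q (M^q N) p p'` with `R
= ∏ ρ_i`, `r = R^{-(s-1)}` and `M` equal to `R⁻¹` times the product over one period. The nonnegative
matrix `M` fixes the positive vector `x`, so its powers are bounded and the Abel means converge
(`exists_tendsto_abel_mean`), even if `M^q` itself oscillates. Since `(s-1)/(1-r)` tends to `1 / log
R`, the residue exists. That `R > 1` comes from the diameter hypothesis, which forces branching
(`one_lt_prod_eigenvalue`).

For fixed `τ` and `s > 1` the expression is the mass of `[η]` under a measure. A limit of these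
measures on clopen sets is finitely additive, hence countably subadditive by compactness, and
extends to a Borel measure; uniqueness holds because cylinders form a π-system. -/

/-! ### Limits of measures on the clopen algebra of a compact space. -/

theorem exists_measure_of_tendsto_isClopen {X α : Type*} [TopologicalSpace X] [CompactSpace X]
    [MeasurableSpace X] [BorelSpace X]
    (hgen : borel X = MeasurableSpace.generateFrom {s : Set X | IsClopen s})
    (l : Filter α) [NeBot l] (m : α → Measure X) {c : ℝ≥0∞} (hc : c ≠ ⊤)
    (h : Tendsto (fun a => m a Set.univ) l (𝓝 c)) :
    ∃ μ : Measure X, IsFiniteMeasure μ ∧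
      ∀ s, IsClopen s → ∀ t, Tendsto (fun a => m a s) l (𝓝 t) → μ s = t := by
  have hring : IsSetRing {s : Set X | IsClopen s} :=
    ⟨isClopen_empty, fun s t hs ht => hs.union ht, fun s t hs ht => hs.diff ht⟩
  -- Convergence along `l` is not assumed for every clopen set; an ultrafilter below `l` gives a
  -- limit in the compact space `[0, ∞]` for all of them and respects the limits that already exist.
  let U := Ultrafilter.of l
  have hU : (U : Filter α) ≤ l := Ultrafilter.of_le l
  let F : Set X → ℝ≥0∞ := fun s => (U.map fun a => m a s).lim
  have hF : ∀ s, Tendsto (fun a => m a s) U (𝓝 (F s)) := fun s =>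
    Ultrafilter.le_nhds_lim (U.map fun a => m a s)
  have hval : ∀ s t, Tendsto (fun a => m a s) l (𝓝 t) → F s = t := fun s t ht =>
    tendsto_nhds_unique (hF s) (ht.mono_left hU)
  have hadd : ∀ {s t : Set X}, IsClopen s → IsClopen t → Disjoint s t →
      F (s ∪ t) = F s + F t := by
    intro s t hs ht hd
    refine tendsto_nhds_unique (hF _) ?_
    refine ((hF s).add (hF t)).congr fun a => ?_
    rw [measure_union hd (ht.1.measurableSet)]
  let A : AddContent ℝ≥0∞ {s : Set X | IsClopen s} :=
    hring.addContent_of_union F (hval _ _ (by simp)) hadd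
  have hsub : A.IsSigmaSubadditive := by
    intro f hf hU'
    -- The union is clopen, hence compact, so finitely many of the open sets `f i` cover it and
    -- finite subadditivity of each `m a` suffices.
    obtain ⟨T, hT⟩ := (hU'.1.isCompact).elim_finite_subcover f (fun i => (hf i).2) subset_rfl
    calc A (⋃ i, f i) ≤ ∑ i ∈ T, A (f i) := by
            refine le_of_tendsto_of_tendsto' (hF _) (tendsto_finsetSum T fun i _ => hF (f i)) ?_
            intro a
            exact (measure_mono hT).trans (measure_biUnion_finset_le _ _)
      _ ≤ ∑' i, A (f i) := ENNReal.sum_le_tsum T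
  have hgen' : ‹MeasurableSpace X› = MeasurableSpace.generateFrom {s : Set X | IsClopen s} :=
    (BorelSpace.measurable_eq).trans hgen
  refine ⟨A.measure hring.isSetSemiring hgen'.le hsub, ⟨?_⟩, fun s hs t ht => ?_⟩
  · rw [AddContent.measure_eq A hring.isSetSemiring hgen' hsub (isClopen_univ)]
    exact (hval _ _ h).trans_lt hc.lt_top
  · rw [AddContent.measure_eq A hring.isSetSemiring hgen' hsub hs]
    exact hval _ _ ht

/-! ### Topology and Borel structure of the path space; extension of finite paths. -/

namespace BratteliDiagram

variable {B : BratteliDiagram.{u}}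

theorem FinPath.ext_of_edge {n : ℕ} {γ γ' : B.FinPath n} (h0 : γ.root = γ'.root)
    (h : γ.edge = γ'.edge) : γ = γ' := by
  cases γ
  cases γ'
  simp_all

instance (n : ℕ) : Finite (B.FinPath n) := by
  have := B.finite_V
  have := B.finite_E
  refine Finite.of_injective (β := B.V 0 × ∀ i : Fin n, B.E i) (fun γ => (γ.root, γ.edge)) ?_
  intro γ γ' h
  exact FinPath.ext_of_edge (congrArg Prod.fst h) (congrArg Prod.snd h)

instance (n : ℕ) : Fintype (B.FinPath n) := Fintype.ofFinite _

/-- One edge more than the length is compared, because for a path of length `0` the root is read off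
from the first edge. -/
theorem InfPath.mem_cylinder_of_forall_edge {x y : B.InfPath} {η : B.Paths}
    (hx : x ∈ cylinder η) (h : ∀ i < η.1 + 1, y.1 i = x.1 i) : y ∈ cylinder η := by
  refine Eq.trans ?_ hx
  refine FinPath.ext_of_edge ?_ ?_
  · change B.r (y.1 0) = B.r (x.1 0)
    rw [h 0 (Nat.succ_pos _)]
  · funext i
    exact h i (i.2.trans (Nat.lt_succ_self _))

/-- Each edge set is finite, so along an ultrafilter every coordinate is eventually constant; the
constants form a path, which is the limit. -/
instance : CompactSpace B.InfPath := by
  refine ⟨isCompact_iff_ultrafilter_le_nhds.mpr fun U _ => ?_⟩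
  have hE := B.finite_E
  have hev : ∀ n, ∃ e : B.E n, ∀ᶠ x : B.InfPath in U, x.1 n = e := by
    intro n
    obtain ⟨e, he⟩ := Ultrafilter.eq_pure_of_finite (U.map fun x : B.InfPath => x.1 n)
    refine ⟨e, ?_⟩
    have : {e} ∈ U.map fun x : B.InfPath => x.1 n := by rw [he]; exact Ultrafilter.mem_pure.mpr rfl
    exact this
  choose e he using hev
  have hcompat : ∀ n, B.s (e n) = B.r (e (n + 1)) := by
    intro n
    obtain ⟨x, h1, h2⟩ := ((he n).and (he (n + 1))).exists
    rw [← h1, ← h2, x.2 n]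
  let z : B.InfPath := ⟨e, hcompat⟩
  refine ⟨z, Set.mem_univ _, ?_⟩
  rw [TopologicalSpace.nhds_generateFrom]
  simp only [le_iInf_iff, le_principal_iff]
  rintro _ ⟨hx, η, rfl⟩
  have : ∀ᶠ x : B.InfPath in U, ∀ i ∈ Finset.range (η.1 + 1), x.1 i = e i :=
    (Finset.eventually_all _).mpr fun i _ => he i
  filter_upwards [this] with y hy
  exact InfPath.mem_cylinder_of_forall_edge hx fun i hi => hy i (Finset.mem_range.mpr hi)

instance : Countable B.Paths := by
  unfold Paths
  infer_instance

instance : SecondCountableTopology B.InfPath :=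
  ⟨⟨Set.range cylinder, Set.countable_range _, rfl⟩⟩

theorem borel_infPath_eq_generateFrom :
    borel B.InfPath = MeasurableSpace.generateFrom (Set.range (cylinder (B := B))) :=
  borel_eq_generateFrom_of_subbasis rfl

theorem borel_infPath_eq_generateFrom_isClopen :
    borel B.InfPath = MeasurableSpace.generateFrom {s | IsClopen s} := by
  refine le_antisymm ?_ ?_
  · rw [borel_infPath_eq_generateFrom]
    refine MeasurableSpace.generateFrom_mono ?_
    rintro _ ⟨η, rfl⟩
    exact isClopen_cylinder η
  · refine MeasurableSpace.generateFrom_le fun s hs => ?_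
    exact hs.2.measurableSet

/-- The path without its last edge. -/
def FinPath.init {n : ℕ} (γ : B.FinPath (n + 1)) : B.FinPath n where
  root := γ.root
  edge i := γ.edge i.castSucc
  root_eq _ := γ.root_eq (Nat.succ_pos n)
  compat i h := γ.compat i (h.trans (Nat.lt_succ_self n))

theorem FinPath.r_edge_last {n : ℕ} (γ : B.FinPath (n + 1)) :
    B.r (γ.edge (Fin.last n)) = γ.init.source := by
  cases n with
  | zero => exact γ.root_eq (Nat.succ_pos 0)
  | succ n => exact (γ.compat n (Nat.lt_succ_self _)).symm

/-- The path obtained by adding an edge at the source. -/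
def FinPath.snoc {n : ℕ} (γ : B.FinPath n) (e : B.E n) (he : B.r e = γ.source) :
    B.FinPath (n + 1) where
  root := γ.root
  edge := Fin.snoc (α := fun i : Fin (n + 1) => B.E i) γ.edge e
  root_eq h := by
    cases n with
    | zero => exact he
    | succ n =>
      have := Fin.snoc_castSucc (α := fun i : Fin (n + 1 + 1) => B.E i) e γ.edge 0
      exact (congrArg B.r this).trans (γ.root_eq (Nat.succ_pos n))
  compat i h := by
    have h1 := Fin.snoc_castSucc (α := fun i : Fin (n + 1) => B.E i) e γ.edge
      ⟨i, Nat.lt_of_succ_lt_succ h⟩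
    refine (congrArg B.s h1).trans ?_
    rcases (Nat.lt_succ_iff.mp h).lt_or_eq with h2 | h2
    · have h3 := Fin.snoc_castSucc (α := fun i : Fin (n + 1) => B.E i) e γ.edge ⟨i + 1, h2⟩
      exact (γ.compat i h2).trans (congrArg B.r h3).symm
    · subst h2
      have h3 := Fin.snoc_last (α := fun j : Fin (i + 1 + 1) => B.E j) e γ.edge
      exact (Eq.trans (congrArg B.r h3) he).symm

theorem FinPath.init_snoc {n : ℕ} (γ : B.FinPath n) (e : B.E n) (he : B.r e = γ.source) :
    (γ.snoc e he).init = γ := by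
  refine FinPath.ext_of_edge rfl ?_
  funext i
  exact Fin.snoc_castSucc (α := fun i : Fin (n + 1) => B.E i) e γ.edge i

theorem FinPath.edge_last_snoc {n : ℕ} (γ : B.FinPath n) (e : B.E n) (he : B.r e = γ.source) :
    (γ.snoc e he).edge (Fin.last n) = e :=
  Fin.snoc_last (α := fun i : Fin (n + 1) => B.E i) e γ.edge

/-- A path of length `n + 1` is a path of length `n` followed by an edge. -/
def FinPath.succEquiv (n : ℕ) :
    B.FinPath (n + 1) ≃ Σ γ : B.FinPath n, {e : B.E n // B.r e = γ.source} where
  toFun γ := ⟨γ.init, γ.edge (Fin.last n), γ.r_edge_last⟩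
  invFun p := p.1.snoc p.2.1 p.2.2
  left_inv γ := by
    refine FinPath.ext_of_edge rfl ?_
    funext i
    refine Fin.lastCases ?_ (fun j => ?_) i
    · exact FinPath.edge_last_snoc _ _ _
    · exact Fin.snoc_castSucc (α := fun i : Fin (n + 1) => B.E i) _ _ j
  right_inv := by
    rintro ⟨γ, e, he⟩
    have h1 := γ.init_snoc e he
    have h2 := γ.edge_last_snoc e he
    refine Sigma.ext h1 ?_
    refine (Subtype.heq_iff_coe_eq ?_).mpr h2
    intro e'
    simp only [h1]

/-- The initial sub-path of length `m` of a path of length `m + j`. -/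
def FinPath.initial {m : ℕ} : (j : ℕ) → B.FinPath (m + j) → B.FinPath m
  | 0, γ => γ
  | j + 1, γ => FinPath.initial j (FinPath.init γ)

theorem InfPath.initial_take (x : B.InfPath) (m : ℕ) : ∀ j,
    FinPath.initial j (x.take (m + j)) = x.take m
  | 0 => rfl
  | j + 1 => InfPath.initial_take x m j

theorem mem_cylinder_iff_initial_eq {m j : ℕ} {x : B.InfPath} {γ : B.FinPath (m + j)}
    (hx : x ∈ cylinder ⟨m + j, γ⟩) (η : B.FinPath m) :
    x ∈ cylinder ⟨m, η⟩ ↔ FinPath.initial j γ = η := by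
  have hx' : x.take (m + j) = γ := hx
  rw [← hx', InfPath.initial_take]
  rfl

/-- Two cylinders that meet are nested: the longer path extends the shorter one. -/
theorem isPiSystem_range_cylinder : IsPiSystem (Set.range (cylinder (B := B))) := by
  have key : ∀ (m j : ℕ) (η : B.FinPath m) (ξ : B.FinPath (m + j)),
      (cylinder ⟨m, η⟩ ∩ cylinder ⟨m + j, ξ⟩).Nonempty →
        cylinder ⟨m, η⟩ ∩ cylinder ⟨m + j, ξ⟩ = cylinder ⟨m + j, ξ⟩ := by
    rintro m j η ξ ⟨x, hx, hx'⟩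
    rw [Set.inter_eq_right]
    intro y hy
    exact (mem_cylinder_iff_initial_eq hy η).mpr ((mem_cylinder_iff_initial_eq hx' η).mp hx)
  rintro _ ⟨⟨m, η⟩, rfl⟩ _ ⟨⟨n, ξ⟩, rfl⟩ hne
  rcases le_total m n with h | h
  · obtain ⟨j, rfl⟩ := Nat.exists_eq_add_of_le h
    exact ⟨_, (key m j η ξ hne).symm⟩
  · obtain ⟨j, rfl⟩ := Nat.exists_eq_add_of_le h
    rw [Set.inter_comm] at hne ⊢
    exact ⟨_, (key n j ξ η hne).symm⟩

theorem measure_ext_cylinder {μ ν : Measure B.InfPath} [IsFiniteMeasure μ]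
    (h : ∀ η, μ (cylinder η) = ν (cylinder η)) : μ = ν := by
  rcases isEmpty_or_nonempty B.Paths with he | he
  · have : IsEmpty B.InfPath := ⟨fun x => he.false ⟨0, x.take 0⟩⟩
    rw [Measure.eq_zero_of_isEmpty μ, Measure.eq_zero_of_isEmpty ν]
  obtain ⟨f, hf⟩ := exists_surjective_nat B.Paths
  refine Measure.ext_of_generateFrom_of_iUnion (Set.range cylinder) (fun n => cylinder (f n))
    borel_infPath_eq_generateFrom isPiSystem_range_cylinder ?_ (fun n => ⟨_, rfl⟩)
    (fun n => measure_ne_top μ _) ?_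
  · refine Set.eq_univ_of_forall fun x => ?_
    obtain ⟨n, hn⟩ := hf ⟨0, x.take 0⟩
    exact Set.mem_iUnion.mpr ⟨n, by rw [hn]; rfl⟩
  · rintro _ ⟨η, rfl⟩
    exact h η

end BratteliDiagram

/-! ### Counting extensions of a finite path by matrix products. -/

section Stationary

variable {k : ℕ} [NeZero k] {ι : Type u} [Fintype ι] (A : Fin k → Matrix ι ι ℕ)

/-- The edges with a given range. -/
def stationaryBratteliEdgeEquiv (n : ℕ) (p : ι) :
    {e : (stationaryBratteli A).E n // (stationaryBratteli A).r e = p} ≃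
      Σ q : ι, Fin (A (Fin.ofNat k n) p q) where
  toFun e := e.2 ▸ e.1.2
  invFun e := ⟨⟨p, e⟩, rfl⟩
  left_inv := by
    rintro ⟨⟨p', e⟩, rfl⟩
    rfl
  right_inv e := rfl

/-- The source of a finite path, as an element of `ι`. -/
def sourceVertex {n : ℕ} (γ : (stationaryBratteli A).FinPath n) : ι := γ.source

/-- Summing over the last edge first replaces `f` by its image under the adjacency matrix of that
level. -/
theorem sum_finPath_succ (n : ℕ) (F : (stationaryBratteli A).FinPath n → ℝ) (f : ι → ℝ) :
    ∑ γ : (stationaryBratteli A).FinPath (n + 1), F γ.init * f (sourceVertex A γ) =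
      ∑ γ : (stationaryBratteli A).FinPath n,
        F γ * ((A (Fin.ofNat k n)).map (Nat.cast : ℕ → ℝ)).mulVec f (sourceVertex A γ) := by
  classical
  have := (stationaryBratteli A).finite_E
  let _ : ∀ p : ι, Fintype {e : (stationaryBratteli A).E n // (stationaryBratteli A).r e = p} :=
    fun p => Fintype.ofFinite _
  let _ : ∀ γ : (stationaryBratteli A).FinPath n,
      Fintype {e : (stationaryBratteli A).E n // (stationaryBratteli A).r e = γ.source} :=
    fun γ => Fintype.ofFinite _
  rw [← (BratteliDiagram.FinPath.succEquiv (B := stationaryBratteli A) n).symm.sum_comp,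
    Fintype.sum_sigma]
  refine Finset.sum_congr rfl fun γ _ => ?_
  refine ((stationaryBratteliEdgeEquiv A n (sourceVertex A γ)).symm.sum_comp _).symm.trans ?_
  rw [Fintype.sum_sigma]
  simp only [Matrix.mulVec, dotProduct]
  rw [Finset.mul_sum]
  refine Finset.sum_congr rfl fun q _ => ?_
  have : ∀ i : Fin (A (Fin.ofNat k n) (sourceVertex A γ) q),
      F ((BratteliDiagram.FinPath.succEquiv n).symm
        ⟨γ, (stationaryBratteliEdgeEquiv A n (sourceVertex A γ)).symm ⟨q, i⟩⟩).init *
      f (sourceVertex A ((BratteliDiagram.FinPath.succEquiv n).symm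
        ⟨γ, (stationaryBratteliEdgeEquiv A n (sourceVertex A γ)).symm ⟨q, i⟩⟩)) = F γ * f q := by
    intro i
    congr 1
    · exact congrArg F (BratteliDiagram.FinPath.init_snoc γ _
        ((stationaryBratteliEdgeEquiv A n (sourceVertex A γ)).symm ⟨q, i⟩).2)
    · refine congrArg f ?_
      exact congrArg (stationaryBratteli A).s (BratteliDiagram.FinPath.edge_last_snoc γ _
        ((stationaryBratteliEdgeEquiv A n (sourceVertex A γ)).symm ⟨q, i⟩).2)
  rw [Finset.sum_congr rfl fun i _ => this i, Finset.sum_const, Finset.card_univ,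
    Fintype.card_fin, nsmul_eq_mul, Matrix.map_apply]
  ring

variable [DecidableEq ι]

/-- The numbers of paths of length `j` starting at level `m`. -/
def pathCount (m : ℕ) : ℕ → Matrix ι ι ℝ
  | 0 => 1
  | j + 1 => pathCount m j * (A (Fin.ofNat k (m + j))).map (Nat.cast : ℕ → ℝ)

open Classical in
theorem sum_extensions (m j : ℕ) (η : (stationaryBratteli A).FinPath m) (f : ι → ℝ) :
    ∑ γ : (stationaryBratteli A).FinPath (m + j),
      (if γ.initial j = η then 1 else 0) * f (sourceVertex A γ) =
        (pathCount A m j).mulVec f (sourceVertex A η) := by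
  induction j generalizing f with
  | zero =>
    rw [pathCount, Matrix.one_mulVec]
    refine (Finset.sum_eq_single η (fun γ _ hγ => ?_) (by simp)).trans ?_
    · rw [if_neg (show ¬ BratteliDiagram.FinPath.initial 0 γ = η from hγ), zero_mul]
    · rw [if_pos (show BratteliDiagram.FinPath.initial 0 η = η from rfl), one_mul]
  | succ j ih =>
    rw [pathCount, ← Matrix.mulVec_mulVec, ← ih]
    exact sum_finPath_succ A (m + j) (fun γ => if γ.initial j = η then 1 else 0) f

end Stationary

/-! ### Functional calculus and traces of operators diagonal in a Hilbert basis. -/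

section Eigen
variable {H : Type u} [NormedAddCommGroup H] [InnerProductSpace ℂ H]

theorem HilbertBasis.ext_inner {κ : Type*} (b : HilbertBasis κ ℂ H) {x y : H}
    (h : ∀ j, ⟪b j, x⟫_ℂ = ⟪b j, y⟫_ℂ) : x = y := by
  apply b.repr.injective
  ext j
  rw [b.repr_apply_apply, b.repr_apply_apply, h]

theorem HilbertBasis.ext_clm {κ : Type*} (b : HilbertBasis κ ℂ H) {S T : H →L[ℂ] H}
    (h : ∀ j, S (b j) = T (b j)) : S = T := by
  refine ContinuousLinearMap.ext_on (s := Set.range b) ?_ ?_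
  · have := b.dense_span
    rw [Submodule.dense_iff_topologicalClosure_eq_top]
    exact this
  · rintro _ ⟨j, rfl⟩
    exact h j

open Classical in
theorem HilbertBasis.inner_eq_ite {κ : Type*} (b : HilbertBasis κ ℂ H) (i j : κ) :
    ⟪b i, b j⟫_ℂ = if i = j then 1 else 0 :=
  orthonormal_iff_ite.mp b.orthonormal i j

theorem boundedInverse_eq {D : H →ₗ.[ℂ] H} {R : H →L[ℂ] H}
    (h1 : ∀ ψ, ∃ hψ : R ψ ∈ D.domain, D ⟨R ψ, hψ⟩ = ψ) (h2 : ∀ φ : D.domain, R (D φ) = φ) :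
    boundedInverse D = R := by
  have h : ∃ R : H →L[ℂ] H, (∀ ψ, ∃ hψ : R ψ ∈ D.domain, D ⟨R ψ, hψ⟩ = ψ) ∧
      ∀ φ : D.domain, R (D φ) = φ := ⟨R, h1, h2⟩
  rw [boundedInverse, dif_pos h]
  ext ψ
  obtain ⟨hψ, e⟩ := h1 ψ
  have := h.choose_spec.2 ⟨R ψ, hψ⟩
  rwa [e] at this

variable [CompleteSpace H]

/-- For `v ≠ 0` the eigenvalue `a` lies in the spectrum. The functions `g` with `g(T) v = g(a) v`
form a closed subalgebra containing the constants and the identity, hence contain every continuous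
function. -/
theorem cfc_apply_eigenvector {T : H →L[ℂ] H} (hT : IsSelfAdjoint T) {a : ℝ} {v : H}
    (hv : T v = (a : ℂ) • v) (f : ℝ → ℝ) (hf : ContinuousOn f (spectrum ℝ T)) :
    cfc f T v = (f a : ℂ) • v := by
  by_cases hv0 : v = 0
  · simp [hv0]
  have ha : a ∈ spectrum ℝ T := by
    rw [spectrum.mem_iff]
    intro hu
    obtain ⟨S, hS⟩ := hu.exists_left_inv
    have h1 := congrArg (fun R : H →L[ℂ] H => R v) hS
    apply hv0
    simpa [Algebra.algebraMap_eq_smul_one, hv] using h1.symm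
  rw [cfc_apply f T]
  have key : ∀ g : C(spectrum ℝ T, ℝ), cfcHom hT g v = (g ⟨a, ha⟩ : ℂ) • v := by
    have : CompactSpace (spectrum ℝ T) := isCompact_iff_compactSpace.mp (spectrum.isCompact T)
    intro g
    induction g using ContinuousMap.induction_on_of_compact with
    | const r =>
      have : ContinuousMap.const (spectrum ℝ T) r = algebraMap ℝ C(spectrum ℝ T, ℝ) r := rfl
      rw [this, AlgHomClass.commutes]
      simp [Algebra.algebraMap_eq_smul_one]
    | id => rw [cfcHom_id hT]; simpa using hv
    | star_id => rw [map_star, cfcHom_id hT, hT.star_eq]; simpa using hv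
    | add f g hf hg => rw [map_add, add_apply, hf, hg, ← add_smul]; simp
    | mul f g hf hg =>
      rw [map_mul, mul_apply_eq_comp, hg, map_smul, hf, smul_smul]
      simp [mul_comm]
    | frequently f hfr =>
      have hc : IsClosed {g : C(spectrum ℝ T, ℝ) |
          cfcHom hT g v = (g ⟨a, ha⟩ : ℂ) • v} := by
        refine isClosed_eq ?_ ?_
        · exact (ContinuousLinearMap.apply ℂ H v).continuous.comp (cfcHom_continuous hT)
        · exact (Complex.continuous_ofReal.comp (continuous_eval_const _)).smul continuous_const
      exact hc.mem_of_frequently_of_tendsto hfr tendsto_id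
  exact key _

theorem rpow_apply_eigenvector {T : H →L[ℂ] H} (hT : 0 ≤ T) {a : ℝ} {v : H}
    (hv : T v = (a : ℂ) • v) {t : ℝ} (ht : 0 ≤ t) :
    (T ^ t) v = ((a ^ t : ℝ) : ℂ) • v := by
  rw [CFC.rpow_eq_cfc_real (a := T) hT]
  exact cfc_apply_eigenvector (IsSelfAdjoint.of_nonneg hT) hv _
    (Real.continuous_rpow_const ht).continuousOn

theorem abs_apply_eigenvector {R : H →L[ℂ] H} {a : ℝ} (ha : 0 ≤ a) {v : H}
    (hv : (star R * R) v = ((a ^ 2 : ℝ) : ℂ) • v) : CFC.abs R v = (a : ℂ) • v := by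
  rw [CFC.abs, CFC.sqrt_eq_rpow]
  rw [rpow_apply_eigenvector (star_mul_self_nonneg R) hv (by norm_num)]
  rw [← Real.sqrt_eq_rpow, Real.sqrt_sq ha]

/-- By Parseval the quadratic form is `∑ a j |⟪b j, x⟫|²`, a sum of nonnegative terms. -/
theorem HilbertBasis.nonneg_of_eigen {κ : Type*} (b : HilbertBasis κ ℂ H) {T : H →L[ℂ] H}
    {a : κ → ℝ} (ha : ∀ j, 0 ≤ a j) (hT : ∀ j, T (b j) = (a j : ℂ) • b j) : 0 ≤ T := by
  classical
  have hsa : ContinuousLinearMap.adjoint T = T := by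
    refine b.ext_clm fun j => b.ext_inner fun i => ?_
    rw [ContinuousLinearMap.adjoint_inner_right, hT, hT, inner_smul_left, inner_smul_right,
      b.inner_eq_ite]
    by_cases hij : i = j
    · subst hij; simp
    · simp [hij]
  rw [ContinuousLinearMap.nonneg_iff_isPositive]
  refine ContinuousLinearMap.isPositive_def.mpr ⟨?_, fun x => ?_⟩
  · rw [← ContinuousLinearMap.isSelfAdjoint_iff_isSymmetric]
    exact hsa
  · have h1 := b.hasSum_inner_mul_inner (T x) x
    have h2 : HasSum (fun j => (⟪T x, b j⟫_ℂ * ⟪b j, x⟫_ℂ).re) (⟪T x, x⟫_ℂ).re :=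
      (Complex.hasSum_iff _ _).mp h1 |>.1
    rw [ContinuousLinearMap.reApplyInnerSelf_apply]
    refine h2.nonneg fun j => ?_
    rw [← ContinuousLinearMap.adjoint_inner_right, hsa, hT, inner_smul_right,
      ← inner_conj_symm x (b j), mul_assoc, ← Complex.normSq_eq_conj_mul_self]
    rw [← Complex.ofReal_mul, Complex.ofReal_re]
    exact mul_nonneg (ha j) (Complex.normSq_nonneg _)

theorem posTrace_rpow_of_eigen {κ : Type*} (b : HilbertBasis κ ℂ H) {T : H →L[ℂ] H}
    {a : κ → ℝ} (ha : ∀ j, 0 ≤ a j) (hT : ∀ j, T (b j) = (a j : ℂ) • b j) {s : ℝ} (hs : 0 ≤ s) :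
    posTrace b (T ^ s) = ∑' j, ENNReal.ofReal (a j ^ s) := by
  classical
  unfold posTrace
  refine tsum_congr fun j => ?_
  rw [rpow_apply_eigenvector (b.nonneg_of_eigen ha hT) (hT j) hs, inner_smul_right,
    b.inner_eq_ite]
  simp

/-- The values at `s > 1` of the function whose limit defines `HasResidueTrace`, for a diagonal
positive operator. -/
theorem hasResidueTrace_iff_of_eigen {κ : Type*} (b : HilbertBasis κ ℂ H) {T : H →L[ℂ] H}
    {a : κ → ℝ} (ha : ∀ j, 0 ≤ a j) (hT : ∀ j, T (b j) = (a j : ℂ) • b j) (t : ℝ≥0∞) :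
    HasResidueTrace b T t ↔ Tendsto (fun s : ℝ => ENNReal.ofReal (s - 1) *
      ∑' j, ENNReal.ofReal (a j ^ s)) (𝓝[>] 1) (𝓝 t) := by
  refine tendsto_congr' ?_
  filter_upwards [self_mem_nhdsWithin] with s hs
  rw [posTrace_rpow_of_eigen b ha hT (zero_le_one.trans (le_of_lt hs))]

theorem hasResidueTrace_zero {κ : Type*} (b : HilbertBasis κ ℂ H) : HasResidueTrace b 0 0 := by
  refine tendsto_const_nhds.congr' ?_
  filter_upwards [self_mem_nhdsWithin] with s hs
  have hs' : s ≠ 0 := (zero_lt_one.trans hs).ne'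
  rw [CFC.rpow_eq_cfc_real (a := (0 : H →L[ℂ] H)) le_rfl, cfc_apply_zero, Real.zero_rpow hs']
  simp [posTrace]

theorem absNegPow_eq_zero {D : H →ₗ.[ℂ] H} (hD : boundedInverse D = 0) {t : ℝ} (ht : t ≠ 0) :
    absNegPow D t = 0 := by
  rw [absNegPow, hD, CFC.abs_zero, CFC.rpow_eq_cfc_real (a := (0 : H →L[ℂ] H)) le_rfl,
    cfc_apply_zero, Real.zero_rpow ht, map_zero]

theorem absNegPow_apply_eigenvector {D : H →ₗ.[ℂ] H} {a : ℝ} (ha : 0 ≤ a) {v : H}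
    (hv : (star (boundedInverse D) * boundedInverse D) v = ((a ^ 2 : ℝ) : ℂ) • v) {t : ℝ}
    (ht : 0 ≤ t) : absNegPow D t v = ((a ^ t : ℝ) : ℂ) • v := by
  have h0 : 0 ≤ CFC.abs (boundedInverse D) := by rw [CFC.abs]; exact CFC.sqrt_nonneg _
  exact rpow_apply_eigenvector h0 (abs_apply_eigenvector ha hv) ht

end Eigen

/-! ### The Dirac operator and the representation in the standard basis. -/

section Blocks
variable {ι : Type u}

/-- The bounded operator with blocks `b γ` maps into the maximal domain, since applying the `a γ`
afterwards returns the original `ℓ²` vector. -/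
theorem blockDiag_inverse (a b : ι → Matrix (Fin 2) (Fin 2) ℂ) (hab : ∀ γ, a γ * b γ = 1)
    (hba : ∀ γ, b γ * a γ = 1) {K : ℝ} (hK : 0 ≤ K)
    (hb : ∀ γ, ‖Matrix.toEuclideanCLM (𝕜 := ℂ) (b γ)‖ ≤ K) :
    boundedInverse (blockDiag a) =
      lp.mapCLM 2 (fun γ => Matrix.toEuclideanCLM (𝕜 := ℂ) (b γ)) hK hb := by
  have hab' : ∀ γ ψ, Matrix.toEuclideanCLM (𝕜 := ℂ) (a γ)
      (Matrix.toEuclideanCLM (𝕜 := ℂ) (b γ) ψ) = ψ := fun γ ψ => by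
    rw [← mul_apply_eq_comp, ← map_mul, hab, map_one]; rfl
  have hba' : ∀ γ ψ, Matrix.toEuclideanCLM (𝕜 := ℂ) (b γ)
      (Matrix.toEuclideanCLM (𝕜 := ℂ) (a γ) ψ) = ψ := fun γ ψ => by
    rw [← mul_apply_eq_comp, ← map_mul, hba, map_one]; rfl
  refine boundedInverse_eq (fun ψ => ?_) (fun φ => ?_)
  · have e : (fun γ => Matrix.toEuclideanCLM (𝕜 := ℂ) (a γ)
        ((lp.mapCLM 2 (fun γ => Matrix.toEuclideanCLM (𝕜 := ℂ) (b γ)) hK hb ψ) γ)) = ψ := by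
      funext γ
      exact hab' γ _
    refine ⟨?_, ?_⟩
    · change Memℓp _ 2
      rw [e]
      exact lp.memℓp ψ
    · ext1
      exact e
  · ext1
    funext γ
    exact hba' γ _

end Blocks

namespace BratteliDiagram

variable {B : BratteliDiagram.{u}}

/-- `D⁻¹` swaps the two basis vectors over `γ` with factor `diam[γ]`, so `(D⁻¹)* D⁻¹` is diagonal
with entries `diam[γ]²`. The bound `K` makes `D⁻¹` bounded. -/
theorem absNegPow_dirac_stdBasis {w : B.Paths → ℝ} (hpos : ∀ γ, 0 < diam w γ) {K : ℝ}
    (hK : ∀ γ, diam w γ ≤ K) {δ : ℝ} (hδ : 0 ≤ δ) (p : B.Paths × Fin 2) :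
    absNegPow (dirac w) δ (stdBasis B.Paths p) =
      ((diam w p.1 ^ δ : ℝ) : ℂ) • stdBasis B.Paths p := by
  classical
  let b : B.Paths → Matrix (Fin 2) (Fin 2) ℂ := fun γ => (diam w γ : ℂ) • !![0, 1; 1, 0]
  have hne : ∀ γ, (diam w γ : ℂ) ≠ 0 := fun γ => by exact_mod_cast (hpos γ).ne'
  have hsq : (!![0, 1; 1, 0] : Matrix (Fin 2) (Fin 2) ℂ) * !![0, 1; 1, 0] = 1 := by
    simp [Matrix.one_fin_two]
  have hb : ∀ γ, ‖Matrix.toEuclideanCLM (𝕜 := ℂ) (b γ)‖ ≤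
      max K 0 * ‖Matrix.toEuclideanCLM (𝕜 := ℂ) (!![0, 1; 1, 0] : Matrix (Fin 2) (Fin 2) ℂ)‖ := by
    intro γ
    rw [map_smul, norm_smul, Complex.norm_real, Real.norm_of_nonneg (hpos γ).le]
    gcongr
    exact (hK γ).trans (le_max_left _ _)
  have hinv : boundedInverse (dirac w) = lp.mapCLM 2
      (fun γ => Matrix.toEuclideanCLM (𝕜 := ℂ) (b γ)) (by positivity) hb := by
    refine blockDiag_inverse _ b (fun γ => ?_) (fun γ => ?_) (by positivity) hb
    · simp only [b]
      rw [smul_mul_smul_comm, hsq]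
      simp [hne γ]
    · simp only [b]
      rw [smul_mul_smul_comm, hsq]
      simp [hne γ]
  set R := boundedInverse (dirac w) with hR
  have hRb : ∀ q : B.Paths × Fin 2, R (stdBasis B.Paths q) =
      (diam w q.1 : ℂ) • stdBasis B.Paths (q.1, 1 - q.2) := by
    rintro ⟨γ, i⟩
    rw [hinv, stdBasis_apply, stdBasis_apply]
    ext1
    funext γ'
    change Matrix.toEuclideanCLM (𝕜 := ℂ) (b γ') _ = _
    rw [lp.coeFn_smul, Pi.smul_apply, lp.single_apply, lp.single_apply]
    by_cases h : γ' = γ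
    · subst h
      ext j
      fin_cases i <;> fin_cases j <;>
        simp [b, Matrix.ofLp_toEuclideanCLM, Matrix.mulVec, dotProduct]
    · simp [h]
  refine absNegPow_apply_eigenvector (hpos _).le ((stdBasis B.Paths).ext_inner fun q => ?_) hδ
  rw [mul_apply_eq_comp, ContinuousLinearMap.star_eq_adjoint,
    ContinuousLinearMap.adjoint_inner_right, hRb, hRb, inner_smul_left, inner_smul_right,
    inner_smul_right, HilbertBasis.inner_eq_ite, HilbertBasis.inner_eq_ite]
  by_cases h : q = p
  · subst h; simp [sq]
  · have : (q.1, 1 - q.2) ≠ (p.1, 1 - p.2) := by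
      intro h'
      apply h
      simpa [Prod.ext_iff] using h'
    simp [h, this]

theorem rep_cylinderChar_stdBasis {w : B.Paths → ℝ} (τ : ChoiceFunction w) (η γ : B.Paths)
    (i : Fin 2) : rep τ (cylinderChar η) (stdBasis B.Paths (γ, i)) =
      (((cylinder η).indicator (fun _ => (1 : ℝ)) (if i = 0 then τ.plus γ else τ.minus γ) : ℝ) : ℂ) •
        stdBasis B.Paths (γ, i) := by
  classical
  have hc : ∀ x, cylinderChar η x = (((cylinder η).indicator (fun _ => (1 : ℝ)) x : ℝ) : ℂ) := by
    intro x
    change (cylinder η).indicator (fun _ => (1 : ℂ)) x = _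
    by_cases hx : x ∈ cylinder η <;> simp [hx]
  rw [stdBasis_apply]
  ext1
  funext γ'
  change Matrix.toEuclideanCLM (𝕜 := ℂ) _ _ = _
  rw [lp.coeFn_smul, Pi.smul_apply, lp.single_apply, hc, hc]
  by_cases h : γ' = γ
  · subst h
    ext j
    fin_cases i <;> fin_cases j <;>
      simp [Matrix.ofLp_toEuclideanCLM, Matrix.mulVec, dotProduct]
  · simp [h]

/-- The defining limit of `HasDixmierValue`, as a sum over all finite paths. -/
theorem hasDixmierValue_iff {w : B.Paths → ℝ} (hpos : ∀ γ, 0 < diam w γ) {K : ℝ}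
    (hK : ∀ γ, diam w γ ≤ K) {δ : ℝ} (hδ : 0 ≤ δ) (τ : ChoiceFunction w) (η : B.Paths)
    (t : ℝ≥0∞) :
    HasDixmierValue τ δ η t ↔ Tendsto (fun s : ℝ => ENNReal.ofReal (s - 1) *
      ∑' γ, ((cylinder η).indicator 1 (τ.plus γ) + (cylinder η).indicator 1 (τ.minus γ)) *
        ENNReal.ofReal (diam w γ ^ (δ * s))) (𝓝[>] 1) (𝓝 t) := by
  have hT : ∀ p : B.Paths × Fin 2,
      (rep τ (cylinderChar η) * absNegPow (dirac w) δ) (stdBasis B.Paths p) =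
      (((cylinder η).indicator (fun _ => (1 : ℝ)) (if p.2 = 0 then τ.plus p.1 else τ.minus p.1) *
        diam w p.1 ^ δ : ℝ) : ℂ) • stdBasis B.Paths p := by
    intro p
    rw [mul_apply_eq_comp, absNegPow_dirac_stdBasis hpos hK hδ, map_smul,
      rep_cylinderChar_stdBasis, smul_smul, mul_comm, Complex.ofReal_mul]
  rw [HasDixmierValue, hasResidueTrace_iff_of_eigen _ (fun p => mul_nonneg
    (Set.indicator_nonneg (by simp) _) (Real.rpow_nonneg (hpos _).le _)) hT]
  refine tendsto_congr' ?_
  filter_upwards [self_mem_nhdsWithin] with s hs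
  -- Needed for `0 ^ s = 0`, so that raising to the power `s` preserves the indicator.
  have hs' : s ≠ 0 := (zero_lt_one.trans hs).ne'
  have hterm : ∀ x γ, ENNReal.ofReal (((cylinder η).indicator (fun _ => (1 : ℝ)) x *
      diam w γ ^ δ) ^ s) = (cylinder η).indicator 1 x *
        ENNReal.ofReal (diam w γ ^ (δ * s)) := by
    intro x γ
    by_cases hx : x ∈ cylinder η
    · simp [hx, Real.rpow_mul (hpos γ).le]
    · simp [hx, Real.zero_rpow hs']
  congr 1
  refine (ENNReal.tsum_prod (f := fun γ (i : Fin 2) => ENNReal.ofReal (((cylinder η).indicator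
    (fun _ => (1 : ℝ)) (if i = 0 then τ.plus γ else τ.minus γ) * diam w γ ^ δ) ^ s))).trans ?_
  refine tsum_congr fun γ => ?_
  rw [tsum_fintype, Fin.sum_univ_two]
  simp only [hterm, if_true, one_ne_zero, if_false]
  rw [add_mul]

theorem hasDixmierValue_zero_of_diam_eq_zero {w : B.Paths → ℝ} (h0 : ∀ γ, diam w γ = 0)
    {δ : ℝ} (hδ : 0 < δ) (τ : ChoiceFunction w) (η : B.Paths) : HasDixmierValue τ δ η 0 := by
  -- As `1 / 0 = 0`, the Dirac operator vanishes here. A right inverse would force every vector to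
  -- be `0`, so both branches of the definition give the zero operator.
  have hR : boundedInverse (dirac w) = 0 := by
    rw [boundedInverse]
    split_ifs with h
    · ext1 ψ
      obtain ⟨hψ, e⟩ := h.choose_spec.1 ψ
      have hz : dirac w ⟨h.choose ψ, hψ⟩ = 0 := by
        ext1
        funext γ
        change Matrix.toEuclideanCLM (𝕜 := ℂ) _ _ = _
        simp [h0]
      rw [← e, hz]
      simp
    · rfl
  rw [HasDixmierValue, absNegPow_eq_zero hR hδ.ne', mul_zero]
  exact hasResidueTrace_zero _

end BratteliDiagram

/-! ### Abel means of power bounded operators, and the passage to residues. -/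

section Abel

variable {E : Type*} [NormedAddCommGroup E] [NormedSpace ℝ E]

theorem summable_geometric_smul [CompleteSpace E] {g : ℕ → E} {C : ℝ} (hC : ∀ q, ‖g q‖ ≤ C)
    {r : ℝ} (h0 : 0 ≤ r) (h1 : r < 1) : Summable fun q => r ^ q • g q := by
  refine Summable.of_norm_bounded ((summable_geometric_of_lt_one h0 h1).mul_right C) fun q => ?_
  rw [norm_smul, Real.norm_of_nonneg (pow_nonneg h0 q)]
  exact mul_le_mul_of_nonneg_left (hC q) (pow_nonneg h0 q)

theorem norm_abel_mean_le {g : ℕ → E} {C : ℝ} (hC : ∀ q, ‖g q‖ ≤ C)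
    {r : ℝ} (h0 : 0 ≤ r) (h1 : r < 1) : ‖(1 - r) • ∑' q, r ^ q • g q‖ ≤ C := by
  have hs := (hasSum_geometric_of_lt_one h0 h1).mul_right C
  have h : ‖∑' q, r ^ q • g q‖ ≤ (1 - r)⁻¹ * C := tsum_of_norm_bounded hs fun q => by
    rw [norm_smul, Real.norm_of_nonneg (pow_nonneg h0 q)]
    exact mul_le_mul_of_nonneg_left (hC q) (pow_nonneg h0 q)
  have h2 : 0 < 1 - r := sub_pos.mpr h1
  rw [norm_smul, Real.norm_of_nonneg h2.le]
  calc (1 - r) * ‖∑' q, r ^ q • g q‖ ≤ (1 - r) * ((1 - r)⁻¹ * C) := by gcongr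
    _ = C := by field_simp

/-- If `f = g - T g` is fixed by `T`, then `T^q g = g - q f`, which is bounded in `q` only for `f =
0`. -/
theorem disjoint_ker_range_of_bounded_pow (T : E →ₗ[ℝ] E)
    (hT : ∀ f, ∃ C, ∀ q : ℕ, ‖(T ^ q) f‖ ≤ C) :
    Disjoint (LinearMap.ker (1 - T)) (LinearMap.range (1 - T)) := by
  rw [Submodule.disjoint_def]
  rintro f hf ⟨g, hg⟩
  have hf' : T f = f := by
    have : f - T f = 0 := hf
    exact (sub_eq_zero.mp this).symm
  have hg' : T g = g - f := by
    have : g - T g = f := hg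
    rw [← this]
    abel
  have key : ∀ q : ℕ, (T ^ q) g = g - (q : ℝ) • f := by
    intro q
    induction q with
    | zero => simp
    | succ q ih =>
      rw [pow_succ', Module.End.mul_apply, ih, map_sub, map_smul, hf', hg']
      push_cast
      module
  obtain ⟨C, hC⟩ := hT g
  by_contra hne
  have hpos : 0 < ‖f‖ := norm_pos_iff.mpr hne
  obtain ⟨n, hn⟩ := exists_nat_gt ((C + ‖g‖) / ‖f‖)
  rw [div_lt_iff₀ hpos] at hn
  have h1 : ‖(n : ℝ) • f‖ ≤ C + ‖g‖ := by
    have : (n : ℝ) • f = g - (T ^ n) g := by rw [key]; abel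
    rw [this]
    refine (norm_sub_le _ _).trans ?_
    linarith [hC n]
  rw [norm_smul, Real.norm_natCast] at h1
  linarith

/-- The mean ergodic theorem for Abel means of a power bounded operator in finite dimension. -/
theorem exists_tendsto_abel_mean [FiniteDimensional ℝ E] (T : E →ₗ[ℝ] E)
    (hT : ∀ f, ∃ C, ∀ q : ℕ, ‖(T ^ q) f‖ ≤ C) (f : E) :
    ∃ L, Tendsto (fun r : ℝ => (1 - r) • ∑' q : ℕ, r ^ q • (T ^ q) f) (𝓝[<] 1) (𝓝 L) := by
  have : CompleteSpace E := FiniteDimensional.complete ℝ E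
  -- Rank-nullity turns disjointness into a direct sum. The limit is the component `g` in the
  -- kernel.
  have htop : LinearMap.ker (1 - T) ⊔ LinearMap.range (1 - T) = ⊤ := by
    refine Submodule.eq_top_of_disjoint _ _ ?_ (disjoint_ker_range_of_bounded_pow T hT)
    rw [add_comm, LinearMap.finrank_range_add_finrank_ker]
  obtain ⟨g, hg, h, ⟨k, rfl⟩, rfl⟩ := Submodule.mem_sup.mp (htop ▸ Submodule.mem_top (x := f))
  have hTg : ∀ q : ℕ, (T ^ q) g = g := by
    have hg' : T g = g := by
      have : g - T g = 0 := hg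
      exact (sub_eq_zero.mp this).symm
    intro q
    induction q with
    | zero => simp
    | succ q ih => rw [pow_succ, Module.End.mul_apply, hg', ih]
  obtain ⟨C, hC⟩ := hT k
  refine ⟨g, ?_⟩
  -- This is the Abel mean of `g + (1 - T) k` after telescoping; the mean of `k` is bounded by `C`,
  -- so the factor `(1 - r) / r` removes everything but `g`.
  have hlim : Tendsto (fun r : ℝ => g + (((1 - r) / r) • k -
      ((1 - r) / r) • ((1 - r) • ∑' q : ℕ, r ^ q • (T ^ q) k))) (𝓝[<] 1) (𝓝 g) := by
    have h0 : Tendsto (fun r : ℝ => (1 - r) / r) (𝓝[<] 1) (𝓝 0) := by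
      have : ContinuousAt (fun r : ℝ => (1 - r) / r) 1 :=
        (continuousAt_const.sub continuousAt_id).div continuousAt_id one_ne_zero
      have h2 := this.tendsto.mono_left (nhdsWithin_le_nhds (s := Set.Iio 1))
      simpa using h2
    have h1 : Tendsto (fun r : ℝ => ((1 - r) / r) • ((1 - r) • ∑' q : ℕ, r ^ q • (T ^ q) k))
        (𝓝[<] 1) (𝓝 0) := by
      refine squeeze_zero_norm' (a := fun r => |(1 - r) / r| * C) ?_ ?_
      · filter_upwards [Ioo_mem_nhdsLT (zero_lt_one' ℝ)] with r hr
        rw [norm_smul, Real.norm_eq_abs]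
        exact mul_le_mul_of_nonneg_left (norm_abel_mean_le hC hr.1.le hr.2) (abs_nonneg _)
      · simpa using h0.abs.mul_const C
    simpa using tendsto_const_nhds.add ((h0.smul_const k).sub h1)
  refine hlim.congr' ?_
  filter_upwards [Ioo_mem_nhdsLT (zero_lt_one' ℝ)] with r hr
  have hr0 : r ≠ 0 := hr.1.ne'
  have hr1 : 1 - r ≠ 0 := (sub_pos.mpr hr.2).ne'
  have hs1 : Summable fun q : ℕ => r ^ q • g :=
    summable_geometric_smul (fun _ => le_rfl) hr.1.le hr.2
  have hs2 := summable_geometric_smul hC hr.1.le hr.2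
  have hs3 : Summable fun q : ℕ => r ^ q • (T ^ (q + 1)) k :=
    summable_geometric_smul (fun q => hC (q + 1)) hr.1.le hr.2
  have e0 : ∀ q : ℕ, r ^ q • (T ^ q) (g + (1 - T) k) =
      r ^ q • g + (r ^ q • (T ^ q) k - r ^ q • (T ^ (q + 1)) k) := by
    intro q
    have : (1 - T) k = k - T k := rfl
    rw [this, map_add, hTg, map_sub, ← Module.End.mul_apply, ← pow_succ, smul_add, smul_sub]
  have e1 : ∑' q : ℕ, r ^ q • g = (1 - r)⁻¹ • g := by
    rw [(summable_geometric_of_lt_one hr.1.le hr.2).tsum_smul_const,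
      tsum_geometric_of_lt_one hr.1.le hr.2]
  have e2 : r • ∑' q : ℕ, r ^ q • (T ^ (q + 1)) k = (∑' q : ℕ, r ^ q • (T ^ q) k) - k := by
    rw [hs2.tsum_eq_zero_add, ← hs3.tsum_const_smul]
    simp [smul_smul, pow_succ']
  have e3 : ∑' q : ℕ, r ^ q • (T ^ (q + 1)) k =
      r⁻¹ • ((∑' q : ℕ, r ^ q • (T ^ q) k) - k) := by
    rw [← e2, smul_smul, inv_mul_cancel₀ hr0, one_smul]
  simp_rw [e0]
  rw [hs1.tsum_add (hs2.sub hs3), hs2.tsum_sub hs3, e1, e3]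
  match_scalars <;> field_simp
  ring

end Abel

section Matrix

variable {ι : Type*} [Fintype ι] [DecidableEq ι]

theorem exists_tendsto_abel_mean_matrix (M R : Matrix ι ι ℝ) {C : ℝ}
    (hC : ∀ (q : ℕ) i j, |(M ^ q) i j| ≤ C) (i j : ι) :
    (∀ r : ℝ, 0 ≤ r → r < 1 → Summable fun q : ℕ => r ^ q * (M ^ q * R) i j) ∧
    ∃ L, Tendsto (fun r : ℝ => (1 - r) * ∑' q : ℕ, r ^ q * (M ^ q * R) i j) (𝓝[<] 1) (𝓝 L) := by
  have happ : ∀ (q : ℕ) (f : ι → ℝ), (Matrix.toLin' M ^ q) f = (M ^ q).mulVec f := by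
    intro q f
    rw [← Matrix.toLin'_pow, Matrix.toLin'_apply]
  have hbd : ∀ f : ι → ℝ, ∃ D, ∀ q : ℕ, ‖(Matrix.toLin' M ^ q) f‖ ≤ D := by
    intro f
    refine ⟨∑ l, |C| * |f l|, fun q => ?_⟩
    rw [happ]
    refine (pi_norm_le_iff_of_nonneg (by positivity)).mpr fun i => ?_
    refine (Finset.abs_sum_le_sum_abs _ _).trans (Finset.sum_le_sum fun l _ => ?_)
    rw [abs_mul]
    exact mul_le_mul_of_nonneg_right ((hC q i l).trans (le_abs_self C)) (abs_nonneg _)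
  have hsum : ∀ r : ℝ, 0 ≤ r → r < 1 →
      Summable fun q : ℕ => r ^ q • (Matrix.toLin' M ^ q) fun l => R l j := by
    intro r h0 h1
    obtain ⟨D, hD⟩ := hbd fun l => R l j
    exact summable_geometric_smul hD h0 h1
  have hval : ∀ (r : ℝ) (q : ℕ), (r ^ q • (Matrix.toLin' M ^ q) fun l => R l j) i =
      r ^ q * (M ^ q * R) i j := by
    intro r q
    rw [happ]
    rfl
  refine ⟨fun r h0 h1 => ?_, ?_⟩
  · exact ((Pi.summable.mp (hsum r h0 h1)) i).congr fun q => hval r q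
  · obtain ⟨L, hL⟩ := exists_tendsto_abel_mean (Matrix.toLin' M) hbd fun l => R l j
    refine ⟨L i, (((continuous_apply i).tendsto L).comp hL).congr' ?_⟩
    filter_upwards [Ioo_mem_nhdsLT (zero_lt_one' ℝ)] with r hr
    simp only [Function.comp_apply, Pi.smul_apply, smul_eq_mul]
    rw [tsum_apply (hsum r hr.1.le hr.2)]
    simp_rw [hval]

/-- Substitute `r = ρ^{-(s-1)}`, which tends to `1` from below; the derivative at `s = 1` gives `(s
- 1) / (1 - r) → 1 / log ρ`. -/
theorem exists_tendsto_residue (M R : Matrix ι ι ℝ) {C : ℝ}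
    (hC : ∀ (q : ℕ) i j, |(M ^ q) i j| ≤ C) (i j : ι) {ρ : ℝ} (hρ : 1 < ρ) :
    (∀ s : ℝ, 1 < s → Summable fun q : ℕ => (ρ ^ (-(s - 1))) ^ q * (M ^ q * R) i j) ∧
    ∃ L, Tendsto (fun s : ℝ => (s - 1) * ∑' q : ℕ, (ρ ^ (-(s - 1))) ^ q * (M ^ q * R) i j)
      (𝓝[>] 1) (𝓝 L) := by
  have hρ0 : 0 < ρ := zero_lt_one.trans hρ
  obtain ⟨hsum, L, hL⟩ := exists_tendsto_abel_mean_matrix M R hC i j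
  have hlt : ∀ s : ℝ, 1 < s → ρ ^ (-(s - 1)) < 1 := fun s hs =>
    Real.rpow_lt_one_of_one_lt_of_neg hρ (by linarith)
  refine ⟨fun s hs => hsum _ (Real.rpow_nonneg hρ0.le _) (hlt s hs), ?_⟩
  have hd : HasDerivAt (fun s : ℝ => ρ ^ (-(s - 1))) (-Real.log ρ) 1 := by
    have h1 : HasDerivAt (fun s : ℝ => -(s - 1)) (-1) 1 := ((hasDerivAt_id 1).sub_const 1).neg
    have h2 := h1.const_rpow hρ0
    simpa using h2
  have hr : Tendsto (fun s : ℝ => ρ ^ (-(s - 1))) (𝓝[>] 1) (𝓝[<] 1) := by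
    refine tendsto_nhdsWithin_iff.mpr ⟨?_, ?_⟩
    · have := hd.continuousAt.tendsto.mono_left (nhdsWithin_le_nhds (s := Set.Ioi 1))
      simpa using this
    · filter_upwards [self_mem_nhdsWithin] with s hs using hlt s hs
  have hslope := (hasDerivAt_iff_tendsto_slope.mp hd).mono_left
    (nhdsWithin_mono (1 : ℝ) fun s (hs : 1 < s) => hs.ne')
  have hlog : -Real.log ρ ≠ 0 := neg_ne_zero.mpr (Real.log_pos hρ).ne'
  refine ⟨-(-Real.log ρ)⁻¹ * L, ((hslope.inv₀ hlog).neg.mul (hL.comp hr)).congr' ?_⟩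
  filter_upwards [self_mem_nhdsWithin] with s hs
  have h1 : 1 - ρ ^ (-(s - 1)) ≠ 0 := (sub_pos.mpr (hlt s hs)).ne'
  have h2 : s - 1 ≠ 0 := (sub_pos.mpr hs).ne'
  simp only [Function.comp_apply, slope_def_field, sub_self, neg_zero, Real.rpow_zero]
  rw [← mul_assoc]
  congr 1
  have h3 : ρ ^ (-(s - 1)) - 1 ≠ 0 := by
    intro h
    exact h1 (by linarith)
  rw [inv_div]
  field_simp
  ring

end Matrix

/-! ### Periodicity of the level weights and of the path counts. -/

section LevelProd

variable {k : ℕ}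

/-- The product of the factors `ρ` attached to the first `n` levels. -/
def levelProd (ρ : Fin k → ℝ) (n : ℕ) : ℝ :=
  ∏ i : Fin k, ρ i ^ (if (i : ℕ) < n % k then n / k + 1 else n / k)

theorem levelProd_zero (ρ : Fin k → ℝ) : levelProd ρ 0 = 1 := by
  simp [levelProd]

theorem levelProd_pos {ρ : Fin k → ℝ} (hρ : ∀ i, 0 < ρ i) (n : ℕ) : 0 < levelProd ρ n :=
  Finset.prod_pos fun i _ => pow_pos (hρ i) _

variable [NeZero k]

theorem levelProd_succ (ρ : Fin k → ℝ) (n : ℕ) :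
    levelProd ρ (n + 1) = ρ (Fin.ofNat k n) * levelProd ρ n := by
  have hk : 0 < k := NeZero.pos k
  -- Only the exponent of the index `n mod k` grows, by one; the two cases are whether `n + 1`
  -- completes a period.
  have hexp : ∀ i : Fin k, (if (i : ℕ) < (n + 1) % k then (n + 1) / k + 1 else (n + 1) / k) =
      (if i = Fin.ofNat k n then 1 else 0) +
        (if (i : ℕ) < n % k then n / k + 1 else n / k) := by
    intro i
    have hi := i.2
    have hieq : i = Fin.ofNat k n ↔ (i : ℕ) = n % k := by rw [Fin.ext_iff, Fin.val_ofNat]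
    have hn := Nat.div_add_mod n k
    have hlt := Nat.mod_lt n hk
    rcases (Nat.succ_le_iff.mpr hlt).lt_or_eq with h | h
    · have h1 : (n + 1) % k = n % k + 1 := by
        rw [Nat.add_mod_eq_ite, Nat.mod_eq_of_lt (a := 1) (by omega), if_neg (by omega)]
      have h2 : (n + 1) / k = n / k := by
        rw [Nat.succ_div, if_neg (by rw [Nat.dvd_iff_mod_eq_zero, h1]; omega), add_zero]
      rw [h1, h2]
      split_ifs <;> omega
    · have h0 : k ∣ n + 1 := ⟨n / k + 1, by rw [mul_add]; omega⟩
      have h1 : (n + 1) % k = 0 := Nat.dvd_iff_mod_eq_zero.mp h0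
      have h2 : (n + 1) / k = n / k + 1 := by rw [Nat.succ_div, if_pos h0]
      rw [h1, h2]
      split_ifs <;> omega
  simp only [levelProd, hexp, pow_add, Finset.prod_mul_distrib]
  congr 1
  simp [Finset.prod_ite_eq']

theorem levelProd_add_period (ρ : Fin k → ℝ) (n : ℕ) :
    levelProd ρ (n + k) = (∏ i, ρ i) * levelProd ρ n := by
  have hk : 0 < k := NeZero.pos k
  rw [levelProd, levelProd, ← Finset.prod_mul_distrib]
  refine Finset.prod_congr rfl fun i _ => ?_
  rw [Nat.add_mod_right, Nat.add_div_right n hk, ← pow_succ']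
  congr 1
  split_ifs <;> omega

theorem levelProd_add_mul_period (ρ : Fin k → ℝ) (n q : ℕ) :
    levelProd ρ (n + q * k) = (∏ i, ρ i) ^ q * levelProd ρ n := by
  induction q with
  | zero => simp
  | succ q ih =>
    rw [Nat.succ_mul, ← add_assoc, levelProd_add_period, ih, pow_succ']
    ring

end LevelProd

section PathCount

variable {k : ℕ} [NeZero k] {ι : Type u} [Fintype ι] [DecidableEq ι] (A : Fin k → Matrix ι ι ℕ)

theorem pathCount_nonneg (m j : ℕ) (p q : ι) : 0 ≤ pathCount A m j p q := by
  induction j generalizing q with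
  | zero =>
    rw [pathCount, Matrix.one_apply]
    split_ifs <;> simp
  | succ j ih =>
    rw [pathCount, Matrix.mul_apply]
    exact Finset.sum_nonneg fun l _ => mul_nonneg (ih l) (by simp)

theorem pathCount_add (m a b : ℕ) :
    pathCount A m (a + b) = pathCount A m a * pathCount A (m + a) b := by
  induction b with
  | zero => simp [pathCount]
  | succ b ih => rw [← add_assoc, pathCount, pathCount, ih, Matrix.mul_assoc, add_assoc]

theorem pathCount_add_period (m j : ℕ) : pathCount A (m + k) j = pathCount A m j := by
  induction j with
  | zero => rfl
  | succ j ih =>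
    have : Fin.ofNat k (m + k + j) = Fin.ofNat k (m + j) := by
      ext
      simp only [Fin.val_ofNat]
      rw [show m + k + j = m + j + k by ring, Nat.add_mod_right]
    rw [pathCount, pathCount, ih, this]

theorem pathCount_mul_period_add (m q t : ℕ) :
    pathCount A m (q * k + t) = pathCount A m k ^ q * pathCount A m t := by
  induction q with
  | zero => simp
  | succ q ih =>
    rw [Nat.succ_mul, show q * k + k + t = k + (q * k + t) by ring, pathCount_add,
      pathCount_add_period, ih, pow_succ', Matrix.mul_assoc]

variable {A} {ρ : Fin k → ℝ} {x : ι → ℝ}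

/-- Each matrix in the product contributes its eigenvalue; the factor `levelProd ρ m` on the left
avoids a quotient. -/
theorem pathCount_mulVec (hx : ∀ i, ((A i).map (Nat.cast : ℕ → ℝ)).mulVec x = ρ i • x)
    (m j : ℕ) : levelProd ρ m • (pathCount A m j).mulVec x = levelProd ρ (m + j) • x := by
  induction j with
  | zero => simp [pathCount]
  | succ j ih =>
    rw [pathCount, ← Matrix.mulVec_mulVec, hx, Matrix.mulVec_smul, smul_comm, ih, ← add_assoc,
      levelProd_succ, smul_smul]

/-- The normalised period matrix is nonnegative and fixes the positive vector `x`, so the `(p, p')`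
entry of any power is at most `x p / x p'`. -/
theorem exists_pathCount_period_bound (hρ : ∀ i, 0 < ρ i) (hx0 : ∀ p, 0 < x p)
    (hx : ∀ i, ((A i).map (Nat.cast : ℕ → ℝ)).mulVec x = ρ i • x) (m : ℕ) :
    ∃ C, ∀ (q : ℕ) p p', |(((∏ i, ρ i)⁻¹ • pathCount A m k) ^ q) p p'| ≤ C := by
  have hR : 0 < ∏ i, ρ i := Finset.prod_pos fun i _ => hρ i
  have hnn : ∀ (q : ℕ) p p', 0 ≤ (((∏ i, ρ i)⁻¹ • pathCount A m k) ^ q) p p' := by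
    intro q p p'
    have h := pathCount_mul_period_add A m q 0
    rw [pathCount, mul_one, add_zero] at h
    rw [smul_pow, ← h, Matrix.smul_apply]
    exact mul_nonneg (by positivity) (pathCount_nonneg A _ _ _ _)
  have hfix : ((∏ i, ρ i)⁻¹ • pathCount A m k).mulVec x = x := by
    have h := pathCount_mulVec hx m k
    rw [levelProd_add_period, mul_comm, ← smul_smul] at h
    have h' := smul_right_injective (ι → ℝ) (levelProd_pos hρ m).ne' h
    rw [Matrix.smul_mulVec, h', smul_smul, inv_mul_cancel₀ hR.ne', one_smul]
  have hfix' : ∀ q : ℕ, (((∏ i, ρ i)⁻¹ • pathCount A m k) ^ q).mulVec x = x := by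
    intro q
    induction q with
    | zero => simp
    | succ q ih => rw [pow_succ, ← Matrix.mulVec_mulVec, hfix, ih]
  refine ⟨∑ p, ∑ p', x p / x p', fun q p p' => ?_⟩
  rw [abs_of_nonneg (hnn q p p')]
  have h1 : (((∏ i, ρ i)⁻¹ • pathCount A m k) ^ q) p p' * x p' ≤ x p := by
    conv_rhs => rw [← hfix' q]
    exact Finset.single_le_sum (f := fun l => (((∏ i, ρ i)⁻¹ • pathCount A m k) ^ q) p l * x l)
      (fun l _ => mul_nonneg (hnn q p l) (hx0 l).le) (Finset.mem_univ p')
  have hdiv : ∀ a b, 0 ≤ x a / x b := fun a b => div_nonneg (hx0 a).le (hx0 b).le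
  calc _ ≤ x p / x p' := (le_div_iff₀ (hx0 p')).mpr h1
    _ ≤ ∑ b, x p / x b := Finset.single_le_sum (f := fun b => x p / x b)
        (fun b _ => hdiv p b) (Finset.mem_univ p')
    _ ≤ _ := Finset.single_le_sum (f := fun a => ∑ b, x a / x b)
        (fun a _ => Finset.sum_nonneg fun b _ => hdiv a b) (Finset.mem_univ p)

theorem exists_tendsto_residue_pathCount (hρ : ∀ i, 0 < ρ i) (hR : 1 < ∏ i, ρ i)
    (hx0 : ∀ p, 0 < x p) (hx : ∀ i, ((A i).map (Nat.cast : ℕ → ℝ)).mulVec x = ρ i • x)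
    (m : ℕ) (p p' : ι) :
    ∃ L : ℝ≥0∞, L ≠ ⊤ ∧ Tendsto (fun s : ℝ => ENNReal.ofReal (s - 1) *
      ∑' j, ENNReal.ofReal (pathCount A m j p p' * levelProd ρ (m + j) ^ (-s)))
        (𝓝[>] 1) (𝓝 L) := by
  obtain ⟨C, hC⟩ := exists_pathCount_period_bound hρ hx0 hx m
  set R := ∏ i, ρ i
  have hR0 : 0 < R := zero_lt_one.trans hR
  set M := R⁻¹ • pathCount A m k
  have hres := fun t : Fin k => exists_tendsto_residue M (pathCount A m t) hC p p' hR
  choose hsum L hL using hres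
  -- Each full period contributes `R^{-s}` from the weight, and `R` from normalising the matrix:
  -- together `R^{-(s-1)}`.
  have hterm : ∀ (s : ℝ) (q : ℕ) (t : Fin k),
      pathCount A m (q * k + t) p p' * levelProd ρ (m + (q * k + t)) ^ (-s) =
        levelProd ρ (m + t) ^ (-s) *
          ((R ^ (-(s - 1))) ^ q * (M ^ q * pathCount A m t) p p') := by
    intro s q t
    have e1 : levelProd ρ (m + (q * k + t)) ^ (-s) =
        levelProd ρ (m + t) ^ (-s) * (R ^ (-s)) ^ q := by
      rw [show m + (q * k + t) = m + t + q * k by ring, levelProd_add_mul_period,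
        Real.mul_rpow (by positivity) (levelProd_pos hρ _).le, mul_comm]
      congr 1
      rw [← Real.rpow_natCast, ← Real.rpow_mul hR0.le, ← Real.rpow_natCast,
        ← Real.rpow_mul hR0.le, mul_comm]
    have e2 : R ^ (-(s - 1)) = R * R ^ (-s) := by
      rw [show -(s - 1) = 1 + -s by ring, Real.rpow_add hR0, Real.rpow_one]
    have e3 : (M ^ q * pathCount A m t) p p' =
        (R⁻¹) ^ q * pathCount A m (q * k + t) p p' := by
      rw [pathCount_mul_period_add, smul_pow, Matrix.smul_mul, Matrix.smul_apply, smul_eq_mul]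
    rw [e1, e2, e3, mul_pow, inv_pow]
    field_simp
  have hnn : ∀ (s : ℝ) (q : ℕ) (t : Fin k),
      0 ≤ (R ^ (-(s - 1))) ^ q * (M ^ q * pathCount A m t) p p' := by
    intro s q t
    have h1 := hterm s q t
    have h2 : 0 ≤ pathCount A m (q * k + t) p p' * levelProd ρ (m + (q * k + t)) ^ (-s) :=
      mul_nonneg (pathCount_nonneg _ _ _ _ _) (Real.rpow_nonneg (levelProd_pos hρ _).le _)
    rw [h1] at h2
    exact nonneg_of_mul_nonneg_right h2 (Real.rpow_pos_of_pos (levelProd_pos hρ _) _)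
  refine ⟨∑ t : Fin k, ENNReal.ofReal (levelProd ρ (m + t) ^ (-1 : ℝ) * L t), by simp, ?_⟩
  have hlim : ∀ t : Fin k, Tendsto (fun s : ℝ => ENNReal.ofReal (levelProd ρ (m + t) ^ (-s) *
      ((s - 1) * ∑' q : ℕ, (R ^ (-(s - 1))) ^ q * (M ^ q * pathCount A m t) p p')))
      (𝓝[>] 1) (𝓝 (ENNReal.ofReal (levelProd ρ (m + t) ^ (-1 : ℝ) * L t))) := by
    intro t
    refine ENNReal.tendsto_ofReal (Tendsto.mul ?_ (hL t))
    have hc : Continuous fun s : ℝ => levelProd ρ (m + t) ^ (-s) :=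
      continuous_const.rpow continuous_neg fun _ => Or.inl (levelProd_pos hρ _).ne'
    exact (hc.tendsto 1).mono_left nhdsWithin_le_nhds
  refine (tendsto_finsetSum Finset.univ fun t _ => hlim t).congr' ?_
  filter_upwards [self_mem_nhdsWithin] with s hs
  have hs1 : 0 ≤ s - 1 := sub_nonneg.mpr (le_of_lt hs)
  rw [← (Nat.divModEquiv k).symm.tsum_eq, ENNReal.tsum_prod', ENNReal.tsum_comm, tsum_fintype,
    Finset.mul_sum]
  refine Finset.sum_congr rfl fun t _ => ?_
  simp only [Nat.divModEquiv_symm_apply]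
  rw [mul_left_comm, ENNReal.ofReal_mul hs1, ← tsum_mul_left, ENNReal.ofReal_tsum_of_nonneg
    (fun q => mul_nonneg (Real.rpow_nonneg (levelProd_pos hρ _).le _) (hnn s q t))
    ((hsum t s hs).mul_left _)]
  congr 1
  refine tsum_congr fun q => ?_
  rw [← hterm]

end PathCount

/-! ### The approximating trace measures. -/

namespace BratteliDiagram

variable {B : BratteliDiagram.{u}}

theorem exists_ne_of_diam_pos {w : B.Paths → ℝ} {η : B.Paths} (h : 0 < diam w η) :
    ∃ y ∈ cylinder η, ∃ z ∈ cylinder η, y ≠ z := by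
  by_contra! hall
  refine h.not_ge (Real.sSup_le ?_ le_rfl)
  rintro _ ⟨y, hy, z, hz, rfl⟩
  rw [dist, if_pos (hall y hy z hz)]

theorem InfPath.take_ne_take {y z : B.InfPath} {n N : ℕ} (hne : y.1 n ≠ z.1 n) (hn : n < N) :
    y.take N ≠ z.take N := by
  intro h
  have h1 : (y.take N).edge = (z.take N).edge := by rw [h]
  exact hne (congrFun h1 ⟨n, hn⟩)

theorem sum_measure_cylinder_vertex (μ : Measure B.InfPath) :
    ∑ v : B.FinPath 0, μ (cylinder ⟨0, v⟩) = μ Set.univ := by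
  rw [← measure_biUnion_finset]
  · congr 1
    refine Set.eq_univ_of_forall fun x => ?_
    simp only [Finset.mem_univ, Set.iUnion_true, Set.mem_iUnion]
    exact ⟨x.take 0, rfl⟩
  · intro v _ v' _ hne
    refine Set.disjoint_left.mpr fun x hx hx' => hne ?_
    exact Eq.trans (Eq.symm hx) hx'
  · exact fun v _ => (isClopen_cylinder _).2.measurableSet

/-- The weighted sum over all finite paths `γ` of the point masses at `τ₊ γ` and `τ₋ γ`, which
represents the functional `f ↦ (s - 1) Tr (π_τ(f) |D|^{-δ s})`. -/
def traceMeasure {w : B.Paths → ℝ} (τ : ChoiceFunction w) (δ s : ℝ) : Measure B.InfPath :=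
  ENNReal.ofReal (s - 1) • Measure.sum fun γ =>
    ENNReal.ofReal (diam w γ ^ (δ * s)) • (Measure.dirac (τ.plus γ) + Measure.dirac (τ.minus γ))

theorem traceMeasure_cylinder {w : B.Paths → ℝ} (τ : ChoiceFunction w) (δ s : ℝ) (η : B.Paths) :
    traceMeasure τ δ s (cylinder η) = ENNReal.ofReal (s - 1) *
      ∑' γ, ((cylinder η).indicator 1 (τ.plus γ) + (cylinder η).indicator 1 (τ.minus γ)) *
        ENNReal.ofReal (diam w γ ^ (δ * s)) := by
  have hm := (isClopen_cylinder η).2.measurableSet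
  rw [traceMeasure, Measure.smul_apply, Measure.sum_apply _ hm, smul_eq_mul]
  congr 1
  refine tsum_congr fun γ => ?_
  rw [Measure.smul_apply, Measure.add_apply, Measure.dirac_apply' _ hm,
    Measure.dirac_apply' _ hm, smul_eq_mul, mul_comm]

end BratteliDiagram

/-! ### Existence of the Dixmier values and of the measure for stationary diagrams. -/

section StationaryDixmier

open BratteliDiagram

variable {k : ℕ} [NeZero k] {ι : Type u} [Fintype ι] {A : Fin k → Matrix ι ι ℕ}
  {ρ : Fin k → ℝ} {x : ι → ℝ} {δ : ℝ} {w : (stationaryBratteli A).Paths → ℝ}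

/-- The weight of a vertex is an entry of `x`, so its cylinder has positive diameter. This supplies
both infinite paths and branching. -/
theorem exists_ne_mem_cylinder_vertex (hx0 : ∀ p, 0 < x p)
    (hw : ∀ n (γ : (stationaryBratteli A).FinPath n),
      w ⟨n, γ⟩ = levelProd ρ n ^ (-1 / δ) * x (sourceVertex A γ))
    (hdiam : ∀ η, w η = diam w η) (γ : (stationaryBratteli A).FinPath 0) :
    ∃ y ∈ cylinder ⟨0, γ⟩, ∃ z ∈ cylinder ⟨0, γ⟩, y ≠ z := by
  refine exists_ne_of_diam_pos (w := w) ?_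
  rw [← hdiam, hw, levelProd_zero, Real.one_rpow, one_mul]
  exact hx0 _

/-- The path of length zero at a vertex. -/
def vertexPath (A : Fin k → Matrix ι ι ℕ) (v : ι) : (stationaryBratteli A).FinPath 0 where
  root := v
  edge i := i.elim0
  root_eq h := absurd h (lt_irrefl 0)
  compat _ h := absurd h (Nat.not_lt_zero _)

/-- The edge of `y` at level `i` shows that `A i` has a positive entry, and `x` is positive. -/
theorem eigenvalue_pos_of_infPath (hx0 : ∀ p, 0 < x p)
    (hx : ∀ i, ((A i).map (Nat.cast : ℕ → ℝ)).mulVec x = ρ i • x)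
    (y : (stationaryBratteli A).InfPath) (i : Fin k) : 0 < ρ i := by
  obtain ⟨p, q, e⟩ : Σ p : ι, Σ q : ι, Fin (A (Fin.ofNat k i) p q) := y.1 i
  have hi : Fin.ofNat k (i : ℕ) = i := by
    ext
    rw [Fin.val_ofNat, Nat.mod_eq_of_lt i.2]
  rw [hi] at e
  have hA : 0 < ((A i).map (Nat.cast : ℕ → ℝ)) p q := by
    rw [Matrix.map_apply]
    exact_mod_cast e.pos
  have h1 : 0 < ((A i).map (Nat.cast : ℕ → ℝ)).mulVec x p := by
    refine (mul_pos hA (hx0 q)).trans_le ?_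
    exact Finset.single_le_sum (f := fun l => ((A i).map (Nat.cast : ℕ → ℝ)) p l * x l)
      (fun l _ => mul_nonneg (by simp) (hx0 l).le) (Finset.mem_univ q)
  rw [hx, Pi.smul_apply, smul_eq_mul] at h1
  exact pos_of_mul_pos_left h1 (hx0 p).le

theorem weight_le_of_one_le_prod (hρ : ∀ i, 0 < ρ i) (hR : 1 ≤ ∏ i, ρ i)
    (hx0 : ∀ p, 0 < x p) (hδ : 0 < δ) (n : ℕ) (p : ι) :
    levelProd ρ n ^ (-1 / δ) * x p ≤
      (∑ t : Fin k, levelProd ρ t ^ (-1 / δ)) * ∑ p, x p := by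
  have hk : 0 < k := NeZero.pos k
  have hpos : ∀ n, 0 ≤ levelProd ρ n ^ (-1 / δ) := fun n =>
    Real.rpow_nonneg (levelProd_pos hρ n).le _
  refine mul_le_mul ?_ (Finset.single_le_sum (fun p _ => (hx0 p).le) (Finset.mem_univ p))
    (hx0 p).le (Finset.sum_nonneg fun t _ => hpos t)
  have h1 : levelProd ρ (n % k) ≤ levelProd ρ n := by
    conv_rhs => rw [← Nat.mod_add_div' n k, levelProd_add_mul_period]
    exact le_mul_of_one_le_left (levelProd_pos hρ _).le (one_le_pow₀ hR)
  refine (Real.rpow_le_rpow_of_nonpos (levelProd_pos hρ _) h1 ?_).trans ?_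
  · exact div_nonpos_of_nonpos_of_nonneg (by norm_num) hδ.le
  · have hsingle : ∀ t₀ : Fin k, levelProd ρ t₀ ^ (-1 / δ) ≤
        ∑ t : Fin k, levelProd ρ t ^ (-1 / δ) := fun t₀ =>
      Finset.single_le_sum (f := fun t : Fin k => levelProd ρ t ^ (-1 / δ))
        (fun t _ => hpos t) (Finset.mem_univ t₀)
    exact hsingle ⟨n % k, Nat.mod_lt n hk⟩

variable [DecidableEq ι]

/-- Start at a vertex `v` where `x` is minimal. After enough full periods at least two paths leave
`v`, each ending at a vertex of value at least `x v`; so a power of `∏ ρ_i` is at least `2`. -/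
theorem one_lt_prod_eigenvalue [Nonempty ι] (hρ : ∀ i, 0 < ρ i) (hx0 : ∀ p, 0 < x p)
    (hx : ∀ i, ((A i).map (Nat.cast : ℕ → ℝ)).mulVec x = ρ i • x)
    (htwo : ∀ γ : (stationaryBratteli A).FinPath 0,
      ∃ y ∈ cylinder ⟨0, γ⟩, ∃ z ∈ cylinder ⟨0, γ⟩, y ≠ z) : 1 < ∏ i, ρ i := by
  classical
  obtain ⟨v, hv⟩ := Finite.exists_min x
  obtain ⟨y, hy, z, hz, hyz⟩ := htwo (vertexPath A v)
  obtain ⟨n, hn⟩ : ∃ n, y.1 n ≠ z.1 n := by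
    by_contra! h
    exact hyz (Subtype.ext (funext h))
  have hk : 0 < k := NeZero.pos k
  -- `n + 1` periods reach beyond the edge where the paths differ. The outer `0` is the starting
  -- level, the inner one the remainder in `levelProd_add_mul_period`.
  have hlt : n < 0 + (0 + (n + 1) * k) := by nlinarith
  have hne := InfPath.take_ne_take hn hlt
  have hsum := sum_extensions A 0 (0 + (n + 1) * k) (vertexPath A v) x
  have hval : (pathCount A 0 (0 + (n + 1) * k)).mulVec x v = (∏ i, ρ i) ^ (n + 1) * x v := by
    have h := pathCount_mulVec hx 0 (0 + (n + 1) * k)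
    rw [zero_add (0 + _), levelProd_add_mul_period, levelProd_zero, one_smul, mul_one] at h
    rw [h]
    rfl
  have hle : ∑ γ ∈ {y.take (0 + (0 + (n + 1) * k)), z.take (0 + (0 + (n + 1) * k))},
      (if FinPath.initial (0 + (n + 1) * k) γ = vertexPath A v then 1 else 0) *
        x (sourceVertex A γ) ≤ (∏ i, ρ i) ^ (n + 1) * x v := by
    rw [← hval]
    refine le_trans ?_ hsum.le
    refine Finset.sum_le_sum_of_subset_of_nonneg (Finset.subset_univ _) fun γ _ _ => ?_
    exact mul_nonneg (by split_ifs <;> simp) (hx0 _).le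
  rw [Finset.sum_pair hne, if_pos ((InfPath.initial_take y 0 _).trans hy),
    if_pos ((InfPath.initial_take z 0 _).trans hz), one_mul, one_mul] at hle
  have h2 : 2 * x v ≤ (∏ i, ρ i) ^ (n + 1) * x v := by
    refine le_trans ?_ hle
    linarith [hv (sourceVertex A (y.take (0 + (0 + (n + 1) * k)))),
      hv (sourceVertex A (z.take (0 + (0 + (n + 1) * k))))]
  have h3 : 2 ≤ (∏ i, ρ i) ^ (n + 1) := le_of_mul_le_mul_right h2 (hx0 v)
  by_contra! hle1
  have := pow_le_one₀ (n := n + 1) (Finset.prod_nonneg fun i _ => (hρ i).le) hle1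
  linarith

/-- The contribution to the trace of the extensions of a finite path by `j` edges. -/
theorem sum_extensions_weight (hρ : ∀ i, 0 < ρ i) (hx0 : ∀ p, 0 < x p) (hδ : 0 < δ)
    (hw : ∀ n (γ : (stationaryBratteli A).FinPath n),
      w ⟨n, γ⟩ = levelProd ρ n ^ (-1 / δ) * x (sourceVertex A γ))
    (τ : ChoiceFunction w) (m j : ℕ) (η : (stationaryBratteli A).FinPath m) (s : ℝ) :
    ∑ γ : (stationaryBratteli A).FinPath (m + j),
      ((cylinder ⟨m, η⟩).indicator 1 (τ.plus ⟨m + j, γ⟩) +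
        (cylinder ⟨m, η⟩).indicator 1 (τ.minus ⟨m + j, γ⟩)) *
        ENNReal.ofReal (w ⟨m + j, γ⟩ ^ (δ * s)) =
      2 * ∑ p, ENNReal.ofReal (x p ^ (δ * s)) * ENNReal.ofReal
        (pathCount A m j (sourceVertex A η) p * levelProd ρ (m + j) ^ (-s)) := by
  classical
  -- The choice function drops out here: on the cylinder of `γ`, membership in `[η]` depends on `γ`
  -- alone.
  have hind : ∀ (γ : (stationaryBratteli A).FinPath (m + j)) (y : (stationaryBratteli A).InfPath),
      y ∈ cylinder ⟨m + j, γ⟩ → (cylinder ⟨m, η⟩).indicator (1 : (stationaryBratteli A).InfPath → ℝ≥0∞) y =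
        ENNReal.ofReal (if γ.initial j = η then 1 else 0) := by
    intro γ y hy
    have h := mem_cylinder_iff_initial_eq hy η
    by_cases hγ : γ.initial j = η
    · simp [hγ, h.mpr hγ]
    · have : y ∉ cylinder ⟨m, η⟩ := fun h' => hγ (h.mp h')
      simp [hγ, this]
  have hW := levelProd_pos hρ (m + j)
  have hpow : ∀ γ : (stationaryBratteli A).FinPath (m + j), w ⟨m + j, γ⟩ ^ (δ * s) =
      levelProd ρ (m + j) ^ (-s) * x (sourceVertex A γ) ^ (δ * s) := by
    intro γ
    rw [hw, Real.mul_rpow (Real.rpow_nonneg hW.le _) (hx0 _).le, ← Real.rpow_mul hW.le]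
    congr 2
    field_simp
  have hite : ∀ γ : (stationaryBratteli A).FinPath (m + j),
      (0 : ℝ) ≤ if γ.initial j = η then 1 else 0 := fun γ => by split_ifs <;> simp
  have hxs : ∀ p, 0 ≤ x p ^ (δ * s) := fun p => Real.rpow_nonneg (hx0 p).le _
  have hWs : 0 ≤ levelProd ρ (m + j) ^ (-s) := Real.rpow_nonneg hW.le _
  calc _ = ∑ γ : (stationaryBratteli A).FinPath (m + j), 2 * (ENNReal.ofReal
        (levelProd ρ (m + j) ^ (-s)) * ENNReal.ofReal ((if γ.initial j = η then 1 else 0) *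
          (fun p => x p ^ (δ * s)) (sourceVertex A γ))) := by
        refine Finset.sum_congr rfl fun γ _ => ?_
        rw [hind γ _ (τ.plus_mem _), hind γ _ (τ.minus_mem _), hpow, ← two_mul,
          ENNReal.ofReal_mul hWs, ENNReal.ofReal_mul (hite γ)]
        ring
    _ = 2 * (ENNReal.ofReal (levelProd ρ (m + j) ^ (-s)) * ENNReal.ofReal
        ((pathCount A m j).mulVec (fun p => x p ^ (δ * s)) (sourceVertex A η))) := by
        rw [← Finset.mul_sum, ← Finset.mul_sum, ← ENNReal.ofReal_sum_of_nonneg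
          (fun γ _ => mul_nonneg (hite γ) (hxs _))]
        exact congrArg (fun r => 2 * (ENNReal.ofReal (levelProd ρ (m + j) ^ (-s)) *
          ENNReal.ofReal r)) (sum_extensions A m j η fun p => x p ^ (δ * s))
    _ = _ := by
        simp only [Matrix.mulVec, dotProduct]
        rw [ENNReal.ofReal_sum_of_nonneg
            (fun p _ => mul_nonneg (pathCount_nonneg _ _ _ _ _) (hxs p)), Finset.mul_sum]
        congr 1
        refine Finset.sum_congr rfl fun p _ => ?_
        rw [ENNReal.ofReal_mul (pathCount_nonneg _ _ _ _ _),
          ENNReal.ofReal_mul (pathCount_nonneg _ _ _ _ _)]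
        ring

/-- The limit defining the Dixmier value of a cylinder set exists, is finite and does not depend
on the choice function. -/
theorem exists_tendsto_trace (hρ : ∀ i, 0 < ρ i) (hR : 1 < ∏ i, ρ i) (hx0 : ∀ p, 0 < x p)
    (hx : ∀ i, ((A i).map (Nat.cast : ℕ → ℝ)).mulVec x = ρ i • x) (hδ : 0 < δ)
    (hw : ∀ n (γ : (stationaryBratteli A).FinPath n),
      w ⟨n, γ⟩ = levelProd ρ n ^ (-1 / δ) * x (sourceVertex A γ))
    (η : (stationaryBratteli A).Paths) :
    ∃ t : ℝ≥0∞, t ≠ ⊤ ∧ ∀ τ : ChoiceFunction w, Tendsto (fun s : ℝ => ENNReal.ofReal (s - 1) *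
      ∑' γ, ((cylinder η).indicator 1 (τ.plus γ) + (cylinder η).indicator 1 (τ.minus γ)) *
        ENNReal.ofReal (w γ ^ (δ * s))) (𝓝[>] 1) (𝓝 t) := by
  obtain ⟨m, η⟩ := η
  choose L hLtop hL using fun p =>
    exists_tendsto_residue_pathCount hρ hR hx0 hx m (sourceVertex A η) p
  have hwpos : ∀ γ, 0 < w γ := by
    rintro ⟨n, γ⟩
    rw [hw]
    exact mul_pos (Real.rpow_pos_of_pos (levelProd_pos hρ n) _) (hx0 _)
  have hcont : ∀ a : ℝ, 0 < a → Tendsto (fun s : ℝ => ENNReal.ofReal (a ^ (δ * s))) (𝓝[>] 1)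
      (𝓝 (ENNReal.ofReal (a ^ δ))) := by
    intro a ha
    have hc : Continuous fun s : ℝ => ENNReal.ofReal (a ^ (δ * s)) :=
      ENNReal.continuous_ofReal.comp
        (continuous_const.rpow (continuous_const.mul continuous_id) fun _ => Or.inl ha.ne')
    have := (hc.tendsto 1).mono_left (nhdsWithin_le_nhds (s := Set.Ioi 1))
    rwa [mul_one] at this
  -- The `0` is the limit of the part from paths shorter than `η`; the `2` counts `τ₊` and `τ₋`.
  refine ⟨0 + 2 * ∑ p, ENNReal.ofReal (x p ^ δ) * L p, ?_, fun τ => ?_⟩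
  · rw [zero_add]
    exact ENNReal.mul_ne_top (by simp) (ENNReal.sum_ne_top.mpr fun p _ =>
      ENNReal.mul_ne_top ENNReal.ofReal_ne_top (hLtop p))
  let F : ℝ → ℕ → ℝ≥0∞ := fun s n => ∑ γ : (stationaryBratteli A).FinPath n,
    ((cylinder ⟨m, η⟩).indicator 1 (τ.plus ⟨n, γ⟩) +
      (cylinder ⟨m, η⟩).indicator 1 (τ.minus ⟨n, γ⟩)) * ENNReal.ofReal (w ⟨n, γ⟩ ^ (δ * s))
  have hsplit : ∀ s : ℝ, ENNReal.ofReal (s - 1) *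
      ∑' γ, ((cylinder ⟨m, η⟩).indicator 1 (τ.plus γ) +
        (cylinder ⟨m, η⟩).indicator 1 (τ.minus γ)) * ENNReal.ofReal (w γ ^ (δ * s)) =
      ENNReal.ofReal (s - 1) * ∑ n ∈ Finset.range m, F s n +
        2 * ∑ p, ENNReal.ofReal (x p ^ (δ * s)) * (ENNReal.ofReal (s - 1) *
          ∑' j, ENNReal.ofReal
            (pathCount A m j (sourceVertex A η) p * levelProd ρ (m + j) ^ (-s))) := by
    intro s
    have h1 : ∑' γ, ((cylinder ⟨m, η⟩).indicator 1 (τ.plus γ) +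
        (cylinder ⟨m, η⟩).indicator 1 (τ.minus γ)) * ENNReal.ofReal (w γ ^ (δ * s)) =
        ∑' n, F s n := by
      rw [ENNReal.tsum_sigma']
      exact tsum_congr fun n => tsum_fintype _
    have h2 : ∑' j, F s (j + m) = 2 * ∑ p, ENNReal.ofReal (x p ^ (δ * s)) *
          ∑' j, ENNReal.ofReal
            (pathCount A m j (sourceVertex A η) p * levelProd ρ (m + j) ^ (-s)) := by
      simp_rw [← ENNReal.tsum_mul_left]
      rw [← tsum_fintype (L := .unconditional _), ENNReal.tsum_comm, ← ENNReal.tsum_mul_left]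
      refine tsum_congr fun j => ?_
      rw [tsum_fintype, add_comm j m]
      exact sum_extensions_weight hρ hx0 hδ hw τ m j η s
    have h3 : ∑ n ∈ Finset.range m, F s n + ∑' j, F s (j + m) = ∑' n, F s n :=
      Summable.sum_add_tsum_nat_add' (f := F s) (k := m) ENNReal.summable
    rw [h1, ← h3, h2, mul_add]
    congr 1
    rw [mul_left_comm, Finset.mul_sum]
    congr 1
    exact Finset.sum_congr rfl fun p _ => mul_left_comm _ _ _
  simp_rw [hsplit]
  refine Tendsto.add ?_ (ENNReal.Tendsto.const_mul (tendsto_finsetSum _ fun p _ =>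
    ENNReal.Tendsto.mul (hcont _ (hx0 p)) (Or.inr (hLtop p)) (hL p)
      (Or.inr ENNReal.ofReal_ne_top)) (Or.inr (by simp)))
  have h0 : Tendsto (fun s : ℝ => ENNReal.ofReal (s - 1)) (𝓝[>] 1) (𝓝 0) := by
    have hc : Continuous fun s : ℝ => ENNReal.ofReal (s - 1) :=
      ENNReal.continuous_ofReal.comp (continuous_id.sub continuous_const)
    simpa using (hc.tendsto 1).mono_left (nhdsWithin_le_nhds (s := Set.Ioi 1))
  have hindtop : ∀ y, (cylinder ⟨m, η⟩).indicator (1 : (stationaryBratteli A).InfPath → ℝ≥0∞) y ≠ ⊤ := by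
    intro y
    by_cases hy : y ∈ cylinder ⟨m, η⟩ <;> simp [hy]
  have hF : Tendsto (fun s => ∑ n ∈ Finset.range m, F s n) (𝓝[>] 1)
      (𝓝 (∑ n ∈ Finset.range m, ∑ γ : (stationaryBratteli A).FinPath n,
        ((cylinder ⟨m, η⟩).indicator 1 (τ.plus ⟨n, γ⟩) +
          (cylinder ⟨m, η⟩).indicator 1 (τ.minus ⟨n, γ⟩)) *
            ENNReal.ofReal (w ⟨n, γ⟩ ^ δ))) :=
    tendsto_finsetSum _ fun n _ => tendsto_finsetSum _ fun γ _ =>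
      ENNReal.Tendsto.const_mul (hcont _ (hwpos _))
        (Or.inr (ENNReal.add_ne_top.mpr ⟨hindtop _, hindtop _⟩))
  have := ENNReal.Tendsto.mul h0 (Or.inr ?_) hF (Or.inr ENNReal.zero_ne_top)
  · simpa using this
  · exact ENNReal.sum_ne_top.mpr fun n _ => ENNReal.sum_ne_top.mpr fun γ _ =>
      ENNReal.mul_ne_top (ENNReal.add_ne_top.mpr ⟨hindtop _, hindtop _⟩) ENNReal.ofReal_ne_top

theorem exists_measure_hasDixmierValue [Nonempty ι] (hx0 : ∀ p, 0 < x p)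
    (hx : ∀ i, ((A i).map (Nat.cast : ℕ → ℝ)).mulVec x = ρ i • x) (hδ : 0 < δ)
    (hw : ∀ n (γ : (stationaryBratteli A).FinPath n),
      w ⟨n, γ⟩ = levelProd ρ n ^ (-1 / δ) * x (sourceVertex A γ))
    (hdiam : ∀ η, w η = diam w η) :
    ∃ μ : Measure (stationaryBratteli A).InfPath, IsFiniteMeasure μ ∧
      ∀ (τ : ChoiceFunction w) η, HasDixmierValue τ δ η (μ (cylinder η)) := by
  have htwo := exists_ne_mem_cylinder_vertex hx0 hw hdiam
  have hρ : ∀ i, 0 < ρ i := by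
    obtain ⟨v⟩ := ‹Nonempty ι›
    obtain ⟨y, -⟩ := htwo (vertexPath A v)
    exact eigenvalue_pos_of_infPath hx0 hx y
  have hR := one_lt_prod_eigenvalue hρ hx0 hx htwo
  have hpos : ∀ γ, 0 < diam w γ := by
    rintro ⟨n, γ⟩
    rw [← hdiam, hw]
    exact mul_pos (Real.rpow_pos_of_pos (levelProd_pos hρ n) _) (hx0 _)
  have hK : ∀ γ, diam w γ ≤ (∑ t : Fin k, levelProd ρ t ^ (-1 / δ)) * ∑ p, x p := by
    rintro ⟨n, γ⟩
    rw [← hdiam, hw]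
    exact weight_le_of_one_le_prod hρ hR.le hx0 hδ n _
  choose t htop ht using exists_tendsto_trace hρ hR hx0 hx hδ hw
  simp_rw [hdiam] at ht
  rcases isEmpty_or_nonempty (ChoiceFunction w) with hτ | ⟨⟨τ₀⟩⟩
  -- The construction of the measure needs one choice function; without any, the claim is vacuous.
  · exact ⟨0, inferInstance, fun τ => (hτ.false τ).elim⟩
  have hcyl : ∀ η, Tendsto (fun s => traceMeasure τ₀ δ s (cylinder η)) (𝓝[>] 1) (𝓝 (t η)) := by
    intro η
    simp_rw [traceMeasure_cylinder]
    exact ht η τ₀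
  have hmass : Tendsto (fun s => traceMeasure τ₀ δ s Set.univ) (𝓝[>] 1)
      (𝓝 (∑ v : (stationaryBratteli A).FinPath 0, t ⟨0, v⟩)) := by
    simp_rw [← sum_measure_cylinder_vertex]
    exact tendsto_finsetSum _ fun v _ => hcyl _
  -- The measure is built from `τ₀` alone; since `t` does not depend on the choice function, it
  -- serves every `τ`.
  obtain ⟨μ, hμ, hval⟩ := exists_measure_of_tendsto_isClopen
    borel_infPath_eq_generateFrom_isClopen (𝓝[>] 1) (traceMeasure τ₀ δ)
    (ENNReal.sum_ne_top.mpr fun v _ => htop _) hmass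
  refine ⟨μ, hμ, fun τ η => ?_⟩
  rw [hasDixmierValue_iff hpos hK hδ.le, hval _ (isClopen_cylinder η) _ (hcyl η)]
  exact ht η τ

end StationaryDixmier

/-! ### Application to higher-rank graphs. -/

namespace HigherRankGraph

variable {k : ℕ} {V : Type u} [Category.{v} V] (Λ : HigherRankGraph k V) [Fintype V]
  [DecidableEq V]

theorem isPerronFrobenius_perron (h : ∃ x, Λ.IsPerronFrobenius x) :
    Λ.IsPerronFrobenius Λ.perron := by
  rw [perron, dif_pos h]
  exact h.choose_spec

variable [NeZero k]

theorem weight_eq (δ : ℝ) (n : ℕ) (γ : (stationaryBratteli Λ.adj).FinPath n) :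
    Λ.weight δ ⟨n, γ⟩ = levelProd Λ.rho n ^ (-1 / δ) * Λ.perron (sourceVertex Λ.adj γ) :=
  rfl

/-- The default value of `perron`, in the absence of a Perron--Frobenius eigenvector, makes the
weight vanish identically. -/
theorem weight_eq_zero (h : ¬ ∃ x, Λ.IsPerronFrobenius x) (δ : ℝ) (η : Λ.bratteli.Paths) :
    Λ.weight δ η = 0 := by
  rw [weight, perron, dif_neg h, Pi.zero_apply, mul_zero]

/-- If `perron` takes its default value `0`, all diameters vanish and the zero measure works;
otherwise the stationary result applies. -/
theorem exists_measure_hasDixmierValue {δ : ℝ} (hδ : 0 < δ)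
    (hdiam : ∀ η : Λ.bratteli.Paths, Λ.weight δ η = BratteliDiagram.diam (Λ.weight δ) η) :
    ∃ μ : Measure Λ.bratteli.InfPath, IsFiniteMeasure μ ∧
      ∀ (τ : BratteliDiagram.ChoiceFunction (Λ.weight δ)) (η : Λ.bratteli.Paths),
        BratteliDiagram.HasDixmierValue τ δ η (μ (BratteliDiagram.cylinder η)) := by
  by_cases h : ∃ x, Λ.IsPerronFrobenius x
  · obtain ⟨hx0, hsum, hx⟩ := Λ.isPerronFrobenius_perron h
    have : Nonempty V := by
      by_contra hV
      rw [not_nonempty_iff] at hV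
      simp at hsum
    exact _root_.exists_measure_hasDixmierValue hx0 hx hδ (Λ.weight_eq δ) hdiam
  · refine ⟨0, inferInstance, fun τ η => ?_⟩
    exact BratteliDiagram.hasDixmierValue_zero_of_diam_eq_zero
      (fun γ => (hdiam γ).symm.trans (Λ.weight_eq_zero h δ γ)) hδ τ η

end HigherRankGraph

end

theorem proposition3p15 {k : ℕ} [NeZero k] {V : Type u} [Fintype V] [DecidableEq V]
    [Category.{v} V] (Λ : HigherRankGraph k V) (hfin : Λ.IsFinite)
    (hconn : Λ.StronglyConnected) (δ : ℝ) (hδ : δ ∈ Set.Ioo (0 : ℝ) 1)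
    (hdiam : ∀ η : Λ.bratteli.Paths,
      Λ.weight δ η = BratteliDiagram.diam (Λ.weight δ) η) :
    ∃ μ : Measure Λ.bratteli.InfPath, IsFiniteMeasure μ ∧
      ∀ τ : BratteliDiagram.ChoiceFunction (Λ.weight δ),
        (∀ η : Λ.bratteli.Paths,
          BratteliDiagram.HasDixmierValue τ δ η (μ (BratteliDiagram.cylinder η))) ∧
        ∀ ν : Measure Λ.bratteli.InfPath, IsFiniteMeasure ν →
          (∀ η : Λ.bratteli.Paths,
            BratteliDiagram.HasDixmierValue τ δ η (ν (BratteliDiagram.cylinder η))) →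
          ν = μ := by
  obtain ⟨μ, hμ, hval⟩ := Λ.exists_measure_hasDixmierValue hδ.1 hdiam
  refine ⟨μ, hμ, fun τ => ⟨hval τ, fun ν hν hvalν => ?_⟩⟩
  exact BratteliDiagram.measure_ext_cylinder fun η =>
    tendsto_nhds_unique (hvalν η) (hval τ η)
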